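/- **Setting.** Let $R$ be a commutative ring with unit. Let $B$ be a finite-dimensional bicommutative Hopf algebra over $\mathbb R$ that is bisemisimple (semisimple as an algebra, with semisimple dual algebra), let $\tau$ be a Hopf algebra automorphism of $B$ with $\tau^2=\mathrm{id}_B$, and let $\psi$ be an $R$-action on $B$ (a unital ring homomorphism from $R$ to the Hopf endomorphisms of $B$, with convolution as addition and composition as multiplication) such that $\psi(r)\circ\tau=\tau\circ\psi(r)$ for all $r\in R$. Let $A=B_{\mathbb C}=\mathbb C\otimes_{\mathbb R}B$, with the coefficient-extended Hopf structure, the $*$-operation $(\lambda\otimes x)^*=\bar\lambda\otimes\tau(x)$, and the $R$-action $\phi=\psi_{\mathbb C}$, $\phi(r)=\mathrm{id}_{\mathbb C}\otimes\psi(r)$. Let $X$ be a short abstract complex over $R$: finite sets $X_+,X_\circ,X_-$ with incidence numbers $[x_+:x_\circ],[x_\circ:x_-]\in R$ such that $\sum_{x_\circ}[x_+:x_\circ][x_\circ:x_-]=0$ for all $x_+,x_-$. Put $V=V(X;A)=\bigotimes_{x_\circ\in X_\circ}A$, a Hopf algebra with the tensor product structure and with $(\otimes v_{x_\circ})^*=\otimes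 v_{x_\circ}^*$. *Integrals and forms.* For a finite-dimensional bicommutative Hopf algebra $C$ over $\mathbb C$ let $\sigma_C\in C$ be the normalized integral ($a\sigma_C=\sigma_C a=\varepsilon(a)\sigma_C$, $\varepsilon(\sigma_C)=1$) and $\sigma^C\colon C\to\mathbb C$ the normalized cointegral ($\sigma^C(a^{(1)})a^{(2)}=a^{(1)}\sigma^C(a^{(2)})=\sigma^C(a)1$, $\sigma^C(1)=1$), when they exist, and put $\mathrm e_C(x,y)=\sigma^C(\sigma_C)^{-1}\sigma^C(xy)$. If $C$ is a Hopf $*$-algebra, put $\mathrm e^*_C(v,w)=\mathrm e_C(v^*,w)$; it is antilinear in $v$ and linear in $w$. *Elementary operator.* For $x_+\in X_+$ and $x_-\in X_-$ define endomorphisms of $V$ by $$\mathbb S^+(x_+)(\otimes v_{x_\circ})=\otimes_{x_\circ}\,\phi([x_+:x_\circ])\big(\sigma_A^{(x_\circ)}\big)\,v_{x_\circ},\qquad \mathbb S^-(x_-)(\otimes v_{x_\circ})=\sigma^A\Big(\prod_{x_\circ}\phi([x_\circ:x_-])\big(v_{x_\circ}^{(2)}\big)\Big)\otimes_{x_\circ}v_{x_\circ}^{(1)},$$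 where $\otimes_{x_\circ}\sigma_A^{(x_\circ)}$ is the iterated comultiplication of $\sigma_A$. The elementary operator is $$\mathbb H=\sum_{x_+\in X_+}\big(\mathrm{id}-\mathbb S^+(x_+)\big)+\sum_{x_-\in X_-}\big(\mathrm{id}-\mathbb S^-(x_-)\big),$$ and $V_0=\ker\mathbb H$. *Homology.* In the category of bicommutative Hopf algebras, where $\otimes$ is the biproduct, the incidence numbers give homomorphisms $$\bigotimes_{X_+}A\xrightarrow{\ \partial_+\ }\bigotimes_{X_\circ}A\xrightarrow{\ \partial_-\ }\bigotimes_{X_-}A$$ with components $\phi([x_+:x_\circ])$ and $\phi([x_\circ:x_-])$, and $\partial_-\circ\partial_+$ is trivial. Let $K=\mathrm{Ker}_H(\partial_-)=\{v\in V: v^{(1)}\otimes\partial_-(v^{(2)})=v\otimes1\}$ be the kernel Hopf algebra, and let $H=H(X;A,\phi)$ be the cokernel Hopf algebra of $\partial_+\colon\bigotimes_{X_+}A\to K$, i.e. the quotient of $K$ by the ideal generated by all $\partial_+(a)-\varepsilon(a)1$, with quotient map $v\mapsto[v]$. It is a Hopf $*$-algebra with $[v]^*=[v^*]$. **Theorem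 202012271301.** The normalized integrals and cointegrals of $A$, $V$ and $H$ exist, and the forms $\mathrm e^*_V$ and $\mathrm e^*_H$ are Hermitian symmetric, $\overline{\mathrm e^*(v,w)}=\mathrm e^*(w,v)$. The elementary operator is Hermitian: $\mathrm e^*_V(\mathbb H v,w)=\mathrm e^*_V(v,\mathbb H w)$ for all $v,w\in V$. Moreover: 1. $V$ is the direct sum of the eigenspaces of $\mathbb H$, and eigenspaces for distinct eigenvalues are orthogonal with respect to $\mathrm e^*_V$. 2. $0$ is an eigenvalue of $\mathbb H$. One has $V_0\subseteq K$, and $$f\colon V_0\to H(X;A,\phi),\qquad f(v)=\sqrt{\frac{\dim_{\mathbb C}V}{\dim_{\mathbb C}K}}\;[v],$$ is a $\mathbb C$-linear isomorphism with $\mathrm e^*_H(f(v),f(w))=\mathrm e^*_V(v,w)$ for all $v,w\in V_0$. So $V_0$ and the homology Hopf $*$-algebra $H(X;A,\phi)$ are isomorphic as vector spaces with Hermitian form. -/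

import Mathlib

open scoped TensorProduct ComplexConjugate

namespace HopfComplex

open Coalgebra Bialgebra HopfAlgebra WithConv

noncomputable section

set_option linter.unusedSectionVars false

section TensorPower

variable {k ι A : Type*} [CommRing k] [Fintype ι] [CommRing A]

section Alg
variable [Algebra k A]

variable (k ι A) in
/-- The tensor power `⨂_{i : ι} A` over `k`. -/
abbrev TensorPower : Type _ := ⨂[k] _ : ι, A

variable (k A) in
/-- The inclusion `a ↦ 1 ⊗ ⋯ ⊗ a ⊗ ⋯ ⊗ 1` of the `i`-th tensor factor. -/
def inclAlg (i : ι) : A →ₐ[k] TensorPower k ι A := by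
  classical exact PiTensorProduct.singleAlgHom (R := k) (A := fun _ : ι => A) i

/-- The algebra homomorphism `⊗ a_i ↦ ∏ f_i(a_i)`. -/
def liftAlg {C : Type*} [CommRing C] [Algebra k C] (f : ι → A →ₐ[k] C) :
    TensorPower k ι A →ₐ[k] C :=
  PiTensorProduct.liftAlgHom
    ((MultilinearMap.mkPiAlgebra k ι C).compLinearMap fun i => (f i).toLinearMap)
    (by simp) (by intro x y; simp [Finset.prod_mul_distrib])

@[simp] theorem liftAlg_tprod {C : Type*} [CommRing C] [Algebra k C] (f : ι → A →ₐ[k] C)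
    (v : ι → A) : liftAlg f (PiTensorProduct.tprod k v) = ∏ i, f i (v i) := by
  refine (PiTensorProduct.lift.tprod _).trans ?_
  simp

@[simp] theorem liftAlg_incl {C : Type*} [CommRing C] [Algebra k C] (f : ι → A →ₐ[k] C)
    (i : ι) (a : A) : liftAlg f (inclAlg k A i a) = f i a := by
  classical
  simp only [inclAlg, PiTensorProduct.singleAlgHom_apply, liftAlg_tprod,
    MonoidHom.mulSingle_apply]
  rw [Finset.prod_eq_single i]
  · simp
  · intro j _ hj; simp [Pi.mulSingle_eq_of_ne hj]
  · simp

theorem algHom_ext' {C : Type*} [Semiring C] [Algebra k C] {f g : TensorPower k ι A →ₐ[k] C}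
    (h : ∀ i a, f (inclAlg k A i a) = g (inclAlg k A i a)) : f = g := by
  classical
  refine PiTensorProduct.algHom_ext fun i => AlgHom.ext fun a => ?_
  have := h i a
  simp only [inclAlg] at this
  simp only [AlgHom.comp_apply]
  convert this

end Alg

section Bialg
variable [Bialgebra k A]

variable (k ι A) in
/-- The comultiplication `⊗ a_i ↦ (⊗ a_i^(1)) ⊗ (⊗ a_i^(2))` of the tensor power. -/
def comulTP : TensorPower k ι A →ₐ[k] TensorPower k ι A ⊗[k] TensorPower k ι A :=
  liftAlg fun i => (Algebra.TensorProduct.map (inclAlg k A i) (inclAlg k A i)).comp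
    (comulAlgHom k A)

variable (k ι A) in
/-- The counit `⊗ a_i ↦ ∏ ε(a_i)` of the tensor power. -/
def counitTP : TensorPower k ι A →ₐ[k] k := liftAlg fun _ => counitAlgHom k A

theorem comulTP_incl (i : ι) (a : A) : comulTP k ι A (inclAlg k A i a) =
    Algebra.TensorProduct.map (inclAlg k A i) (inclAlg k A i) (comul (R := k) a) := by
  rw [comulTP, liftAlg_incl]; rfl

theorem counitTP_incl (i : ι) (a : A) :
    counitTP k ι A (inclAlg k A i a) = counit (R := k) a := by
  rw [counitTP, liftAlg_incl]; rfl

instance : Bialgebra k (TensorPower k ι A) :=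
  Bialgebra.ofAlgHom (comulTP k ι A) (counitTP k ι A)
    (by
      refine algHom_ext' fun i a => ?_
      have h := congrArg (Algebra.TensorProduct.map (inclAlg k A i)
        (Algebra.TensorProduct.map (inclAlg k A i) (inclAlg k A i)))
        (Coalgebra.coassoc_apply (R := k) a)
      have h1 : ∀ x : A ⊗[k] A, (Algebra.TensorProduct.map (comulTP k ι A) (.id k _))
          (Algebra.TensorProduct.map (inclAlg k A i) (inclAlg k A i) x) =
          Algebra.TensorProduct.map (Algebra.TensorProduct.map (inclAlg k A i) (inclAlg k A i))
            (inclAlg k A i) (comul.rTensor A x) := by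
        intro x
        induction x with
        | zero => simp
        | add x y hx hy => simp only [map_add, hx, hy]
        | tmul x y => simp [comulTP_incl]
      have h2 : ∀ x : A ⊗[k] A, (Algebra.TensorProduct.map (.id k _) (comulTP k ι A))
          (Algebra.TensorProduct.map (inclAlg k A i) (inclAlg k A i) x) =
          Algebra.TensorProduct.map (inclAlg k A i)
            (Algebra.TensorProduct.map (inclAlg k A i) (inclAlg k A i)) (comul.lTensor A x) := by
        intro x
        induction x with
        | zero => simp
        | add x y hx hy => simp only [map_add, hx, hy]
        | tmul x y => simp [comulTP_incl]
      have h3 : ∀ x : (A ⊗[k] A) ⊗[k] A, Algebra.TensorProduct.assoc k k k _ _ _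
          (Algebra.TensorProduct.map (Algebra.TensorProduct.map (inclAlg k A i) (inclAlg k A i))
            (inclAlg k A i) x) = Algebra.TensorProduct.map (inclAlg k A i)
            (Algebra.TensorProduct.map (inclAlg k A i) (inclAlg k A i))
            (TensorProduct.assoc k A A A x) := by
        intro x
        induction x with
        | zero => simp
        | add x y hx hy => simp only [map_add, hx, hy]
        | tmul x z =>
          induction x with
          | zero => simp
          | add x y hx hy => simp only [map_add, hx, hy, TensorProduct.add_tmul]
          | tmul x y => simp
      rw [AlgHom.comp_apply, AlgHom.comp_apply, AlgHom.comp_apply, comulTP_incl, h1, h2, ← h]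
      exact h3 _)
    (by
      refine algHom_ext' fun i a => ?_
      have h1 : ∀ x : A ⊗[k] A, (Algebra.TensorProduct.map (counitTP k ι A) (.id k _))
          (Algebra.TensorProduct.map (inclAlg k A i) (inclAlg k A i) x) =
          Algebra.TensorProduct.map (.id k k) (inclAlg k A i) (counit.rTensor A x) := by
        intro x
        induction x with
        | zero => simp
        | add x y hx hy => simp only [map_add, hx, hy]
        | tmul x y => simp [counitTP_incl]
      rw [AlgHom.comp_apply, comulTP_incl, h1, Coalgebra.rTensor_counit_comul]
      simp)
    (by
      refine algHom_ext' fun i a => ?_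
      have h1 : ∀ x : A ⊗[k] A, (Algebra.TensorProduct.map (.id k _) (counitTP k ι A))
          (Algebra.TensorProduct.map (inclAlg k A i) (inclAlg k A i) x) =
          Algebra.TensorProduct.map (inclAlg k A i) (.id k k) (counit.lTensor A x) := by
        intro x
        induction x with
        | zero => simp
        | add x y hx hy => simp only [map_add, hx, hy]
        | tmul x y => simp [counitTP_incl]
      rw [AlgHom.comp_apply, comulTP_incl, h1, Coalgebra.lTensor_counit_comul]
      simp)

theorem comul_incl (i : ι) (a : A) : comul (R := k) (inclAlg k A i a) =
    Algebra.TensorProduct.map (inclAlg k A i) (inclAlg k A i) (comul (R := k) a) :=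
  comulTP_incl i a

theorem counit_incl (i : ι) (a : A) :
    counit (R := k) (inclAlg k A i a) = counit (R := k) a :=
  counitTP_incl i a

variable (k A) in
/-- The inclusion of the `i`-th tensor factor as a homomorphism of bialgebras. -/
def incl (i : ι) : A →ₐc[k] TensorPower k ι A :=
  .ofAlgHom (inclAlg k A i) (AlgHom.ext fun a => counit_incl i a)
    (AlgHom.ext fun a => (comul_incl i a).symm)

@[simp] theorem incl_apply (i : ι) (a : A) : incl k A i a = inclAlg k A i a := rfl

/-- The homomorphism of bialgebras `⊗ a_i ↦ ∏ f_i(a_i)`: the tensor power is the coproduct. -/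
def liftHom {C : Type*} [CommRing C] [Bialgebra k C] (f : ι → A →ₐc[k] C) :
    TensorPower k ι A →ₐc[k] C :=
  .ofAlgHom (liftAlg fun i => (f i : A →ₐ[k] C))
    (algHom_ext' fun i a => by
      rw [AlgHom.comp_apply, liftAlg_incl]
      refine Eq.trans ?_ (counit_incl i a).symm
      exact CoalgHomClass.counit_comp_apply (f i) a)
    (algHom_ext' fun i a => by
      have h1 : ∀ x : A ⊗[k] A, (Algebra.TensorProduct.map (liftAlg fun i => (f i : A →ₐ[k] C))
          (liftAlg fun i => (f i : A →ₐ[k] C)))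
          (Algebra.TensorProduct.map (inclAlg k A i) (inclAlg k A i) x) =
          TensorProduct.map (f i : A →ₗ[k] C) (f i : A →ₗ[k] C) x := by
        intro x
        induction x with
        | zero => simp
        | add x y hx hy => simp only [map_add, hx, hy]
        | tmul x y => simp
      rw [AlgHom.comp_apply, AlgHom.comp_apply, liftAlg_incl]
      refine (congrArg _ (comul_incl i a)).trans ((h1 _).trans ?_)
      exact CoalgHomClass.map_comp_comul_apply (f i) a)

@[simp] theorem liftHom_incl {C : Type*} [CommRing C] [Bialgebra k C] (f : ι → A →ₐc[k] C)
    (i : ι) (a : A) : liftHom f (inclAlg k A i a) = f i a :=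
  liftAlg_incl (fun i => (f i : A →ₐ[k] C)) i a

instance [IsCocomm k A] : IsCocomm k (TensorPower k ι A) where
  comm_comp_comul := by
    have : (Algebra.TensorProduct.comm k _ _).toAlgHom.comp (comulAlgHom k (TensorPower k ι A)) =
        comulAlgHom k (TensorPower k ι A) := by
      refine algHom_ext' fun i a => ?_
      have h1 : ∀ x : A ⊗[k] A, Algebra.TensorProduct.comm k _ _
          (Algebra.TensorProduct.map (inclAlg k A i) (inclAlg k A i) x) =
          Algebra.TensorProduct.map (inclAlg k A i) (inclAlg k A i)
            (TensorProduct.comm k A A x) := by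
        intro x
        induction x with
        | zero => simp
        | add x y hx hy => simp only [map_add, hx, hy]
        | tmul x y => simp
      rw [AlgHom.comp_apply, comulAlgHom_apply, comul_incl]
      refine (h1 _).trans ?_
      rw [comm_comul]
    exact congrArg AlgHom.toLinearMap this

end Bialg

section Hopf
variable [HopfAlgebra k A]

instance : HopfAlgebra k (TensorPower k ι A) :=
  HopfAlgebra.ofAlgHom (liftAlg fun i => (inclAlg k A i).comp (antipodeAlgHom k A))
    (by
      refine algHom_ext' fun i a => ?_
      have h1 : ∀ x : A ⊗[k] A, (Algebra.TensorProduct.lift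
          (liftAlg fun i => (inclAlg k A i).comp (antipodeAlgHom k A))
          (.id k (TensorPower k ι A)) fun _ ↦ Commute.all _)
          (Algebra.TensorProduct.map (inclAlg k A i) (inclAlg k A i) x) =
          inclAlg k A i (LinearMap.mul' k A ((antipode k).rTensor A x)) := by
        intro x
        induction x with
        | zero => simp
        | add x y hx hy => simp only [map_add, hx, hy]
        | tmul x y =>
          refine (Algebra.TensorProduct.lift_tmul ..).trans ?_
          simp
      rw [AlgHom.comp_apply, comulAlgHom_apply, comul_incl, h1,
        mul_antipode_rTensor_comul_apply, AlgHom.comp_apply, counitAlgHom_apply, counit_incl]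
      simp [Algebra.ofId_apply])
    (by
      refine algHom_ext' fun i a => ?_
      have h1 : ∀ x : A ⊗[k] A, (Algebra.TensorProduct.lift (.id k (TensorPower k ι A))
          (liftAlg fun i => (inclAlg k A i).comp (antipodeAlgHom k A)) fun _ _ ↦ Commute.all _ _)
          (Algebra.TensorProduct.map (inclAlg k A i) (inclAlg k A i) x) =
          inclAlg k A i (LinearMap.mul' k A ((antipode k).lTensor A x)) := by
        intro x
        induction x with
        | zero => simp
        | add x y hx hy => simp only [map_add, hx, hy]
        | tmul x y => simp
      rw [AlgHom.comp_apply, comulAlgHom_apply, comul_incl, h1,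
        mul_antipode_lTensor_comul_apply, AlgHom.comp_apply, counitAlgHom_apply, counit_incl]
      simp [Algebra.ofId_apply])

end Hopf
end TensorPower

section Antipode

variable {k A B : Type*} [CommRing k] [CommRing A] [HopfAlgebra k A] [CommRing B] [HopfAlgebra k B]

theorem map_antipode (ξ : A →ₐc[k] B) (a : A) : ξ (antipode k a) = antipode k (ξ a) := by
  have h1 : toConv ((antipodeAlgHom k B).comp (ξ : A →ₐ[k] B)) * toConv (ξ : A →ₐ[k] B) = 1 := by
    have h := AlgHom.convMul_comp_bialgHom_distrib (toConv (antipodeAlgHom k B))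
      (toConv (AlgHom.id k B)) ξ
    rw [AlgHom.antipode_id_cancel] at h
    refine WithConv.ofConv_injective (h.symm.trans ?_)
    refine AlgHom.ext fun a => ?_
    change algebraMap k B (counit (ξ a)) = algebraMap k B (counit a)
    rw [CoalgHomClass.counit_comp_apply]
  have h2 : (toConv (ξ : A →ₐ[k] B))⁻¹ = toConv ((antipodeAlgHom k B).comp (ξ : A →ₐ[k] B)) :=
    (eq_inv_of_mul_eq_one_left h1).symm
  exact DFunLike.congr_fun (congrArg ofConv h2) a

theorem comul_antipode [IsCocomm k A] (a : A) : comul (R := k) (antipode k a) =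
    TensorProduct.map (antipode k) (antipode k) (comul (R := k) a) :=
  map_antipode (comulBialgHom k A) a

end Antipode

section Kernel

variable {k A B : Type*} [Field k] [CommRing A] [HopfAlgebra k A] [IsCocomm k A]
  [CommRing B] [HopfAlgebra k B]

/-- The underlying subalgebra `{a | a^(1) ⊗ ξ(a^(2)) = a ⊗ 1}` of the kernel Hopf algebra of a
homomorphism `ξ : A → B` of bicommutative Hopf algebras. -/
def hopfKer (ξ : A →ₐc[k] B) : Subalgebra k A :=
  AlgHom.equalizer
    ((Algebra.TensorProduct.map (.id k A) (ξ : A →ₐ[k] B)).comp (comulAlgHom k A))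
    (Algebra.TensorProduct.includeLeft : A →ₐ[k] A ⊗[k] B)

theorem mem_hopfKer {ξ : A →ₐc[k] B} {a : A} :
    a ∈ hopfKer ξ ↔ (ξ : A →ₗ[k] B).lTensor A (comul a) = a ⊗ₜ[k] (1 : B) := Iff.rfl

variable (ξ : A →ₐc[k] B)

/-- The linear map with kernel `hopfKer ξ`. -/
def hopfKerDiff : A →ₗ[k] A ⊗[k] B :=
  (ξ : A →ₗ[k] B).lTensor A ∘ₗ comul - (TensorProduct.mk k A B).flip 1

theorem ker_hopfKerDiff :
    LinearMap.ker (hopfKerDiff ξ) = Subalgebra.toSubmodule (hopfKer ξ) := by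
  ext a
  simp only [LinearMap.mem_ker, hopfKerDiff, LinearMap.sub_apply, sub_eq_zero,
    Subalgebra.mem_toSubmodule, mem_hopfKer]
  rfl

theorem lTensor_hopfKerDiff_comul {a : A} (ha : a ∈ hopfKer ξ) :
    (hopfKerDiff ξ).lTensor A (comul a) = 0 := by
  have h1 : ∀ x : A ⊗[k] A, (hopfKerDiff ξ).lTensor A x =
      TensorProduct.assoc k A A B ((TensorProduct.map (.id : A ⊗[k] A →ₗ[k] A ⊗[k] A)
        (ξ : A →ₗ[k] B)) ((TensorProduct.assoc k A A A).symm (comul.lTensor A x))) -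
      TensorProduct.assoc k A A B (x ⊗ₜ[k] (1 : B)) := by
    intro x
    induction x with
    | zero => simp
    | add x y hx hy =>
      simp only [map_add, hx, hy, TensorProduct.add_tmul]
      abel
    | tmul x y =>
      simp only [LinearMap.lTensor_tmul, hopfKerDiff, LinearMap.sub_apply, TensorProduct.tmul_sub]
      congr 1
      simp only [LinearMap.comp_apply]
      generalize (comul (R := k) y) = z
      induction z with
      | zero => simp
      | add x y hx hy => simp only [map_add, TensorProduct.tmul_add, hx, hy]
      | tmul y z => simp
  have h2 : ∀ x : A ⊗[k] A, (TensorProduct.map (.id : A ⊗[k] A →ₗ[k] A ⊗[k] A)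
      (ξ : A →ₗ[k] B)) (comul.rTensor A x) =
      (comul (R := k) (A := A)).rTensor B ((ξ : A →ₗ[k] B).lTensor A x) := by
    intro x
    induction x with
    | zero => simp
    | add x y hx hy => simp only [map_add, hx, hy]
    | tmul x y => simp
  rw [h1, Coalgebra.coassoc_symm_apply, h2, mem_hopfKer.1 ha]
  simp

/-- The inclusion of the kernel as a linear map. -/
abbrev hopfKerIncl : hopfKer ξ →ₗ[k] A := (hopfKer ξ).val.toLinearMap

theorem exact_hopfKer : Function.Exact (hopfKerIncl ξ) (hopfKerDiff ξ) := by
  rw [LinearMap.exact_iff, ker_hopfKerDiff]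
  ext x
  simp

theorem comul_mem {a : A} (ha : a ∈ hopfKer ξ) :
    comul (R := k) a ∈ (Algebra.TensorProduct.map (hopfKer ξ).val (hopfKer ξ).val).range := by
  have hinj : Function.Injective (hopfKerIncl ξ) := Subtype.val_injective
  obtain ⟨y, hy⟩ := ((Module.Flat.lTensor_exact A (exact_hopfKer ξ)) _).1
    (lTensor_hopfKerDiff_comul ξ ha)
  have h0 : (hopfKerDiff ξ).rTensor A (comul a) = 0 := by
    rw [← comm_comul k a]
    refine (congr($(LinearMap.rTensor_comp_comm (hopfKerDiff ξ)) (comul a))).trans ?_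
    rw [LinearMap.comp_apply, lTensor_hopfKerDiff_comul ξ ha, map_zero]
  have h1 : (hopfKerDiff ξ).rTensor (hopfKer ξ) y = 0 := by
    apply Module.Flat.lTensor_preserves_injective_linearMap (M := A ⊗[k] B) _ hinj
    rw [map_zero, ← LinearMap.comp_apply, LinearMap.lTensor_comp_rTensor, ← h0, ← hy,
      ← LinearMap.comp_apply, LinearMap.rTensor_comp_lTensor]
  obtain ⟨z, hz⟩ := ((Module.Flat.rTensor_exact (hopfKer ξ) (exact_hopfKer ξ)) _).1 h1
  refine ⟨z, ?_⟩
  rw [← hy, ← hz, ← LinearMap.comp_apply, LinearMap.lTensor_comp_rTensor]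
  rfl

theorem hopfKer_map_injective : Function.Injective
    (Algebra.TensorProduct.map (hopfKer ξ).val (hopfKer ξ).val) :=
  TensorProduct.map_injective_of_flat_flat _ _ Subtype.val_injective Subtype.val_injective

/-- The comultiplication of the kernel Hopf algebra, the restriction of that of `A`. -/
def hopfKerComul : hopfKer ξ →ₐ[k] hopfKer ξ ⊗[k] hopfKer ξ :=
  ((AlgEquiv.ofInjective _ (hopfKer_map_injective ξ)).symm.toAlgHom).comp
    (((comulAlgHom k A).comp (hopfKer ξ).val).codRestrict _ fun a => comul_mem ξ a.2)

theorem map_hopfKerComul (a : hopfKer ξ) :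
    Algebra.TensorProduct.map (hopfKer ξ).val (hopfKer ξ).val (hopfKerComul ξ a) =
      comul (R := k) (a : A) :=
  congrArg Subtype.val ((AlgEquiv.ofInjective _ (hopfKer_map_injective ξ)).apply_symm_apply
    ((((comulAlgHom k A).comp (hopfKer ξ).val).codRestrict _ fun a => comul_mem ξ a.2) a))

instance : Bialgebra k (hopfKer ξ) :=
  Bialgebra.ofAlgHom (hopfKerComul ξ) ((counitAlgHom k A).comp (hopfKer ξ).val)
    (by
      have hinj : Function.Injective (TensorProduct.map (hopfKerIncl ξ)
        (TensorProduct.map (hopfKerIncl ξ) (hopfKerIncl ξ))) :=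
        TensorProduct.map_injective_of_flat_flat _ _ Subtype.val_injective
          (TensorProduct.map_injective_of_flat_flat _ _ Subtype.val_injective
            Subtype.val_injective)
      refine AlgHom.ext fun a => hinj ?_
      have h1 : ∀ x : hopfKer ξ ⊗[k] hopfKer ξ, TensorProduct.map (hopfKerIncl ξ)
          (TensorProduct.map (hopfKerIncl ξ) (hopfKerIncl ξ))
          (Algebra.TensorProduct.map (.id k _) (hopfKerComul ξ) x) =
          comul.lTensor A (Algebra.TensorProduct.map (hopfKer ξ).val (hopfKer ξ).val x) := by
        intro x
        induction x with
        | zero => simp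
        | add x y hx hy => simp only [map_add, hx, hy]
        | tmul x y =>
          simp only [Algebra.TensorProduct.map_tmul, TensorProduct.map_tmul,
            LinearMap.lTensor_tmul]
          exact congrArg _ (map_hopfKerComul ξ y)
      have h2 : ∀ x : (hopfKer ξ ⊗[k] hopfKer ξ) ⊗[k] hopfKer ξ, TensorProduct.map (hopfKerIncl ξ)
          (TensorProduct.map (hopfKerIncl ξ) (hopfKerIncl ξ))
          (Algebra.TensorProduct.assoc k k k _ _ _ x) = TensorProduct.assoc k A A A
          (TensorProduct.map (TensorProduct.map (hopfKerIncl ξ) (hopfKerIncl ξ))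
            (hopfKerIncl ξ) x) := by
        intro x
        induction x with
        | zero => simp
        | add x y hx hy => simp only [map_add, hx, hy]
        | tmul x z =>
          induction x with
          | zero => simp
          | add x y hx hy => simp only [map_add, hx, hy, TensorProduct.add_tmul]
          | tmul x y => simp
      have h3 : ∀ x : hopfKer ξ ⊗[k] hopfKer ξ, TensorProduct.map
          (TensorProduct.map (hopfKerIncl ξ) (hopfKerIncl ξ)) (hopfKerIncl ξ)
          (Algebra.TensorProduct.map (hopfKerComul ξ) (.id k _) x) =
          comul.rTensor A (Algebra.TensorProduct.map (hopfKer ξ).val (hopfKer ξ).val x) := by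
        intro x
        induction x with
        | zero => simp
        | add x y hx hy => simp only [map_add, hx, hy]
        | tmul x y =>
          simp only [Algebra.TensorProduct.map_tmul, TensorProduct.map_tmul,
            LinearMap.rTensor_tmul]
          exact congrArg (· ⊗ₜ[k] (y : A)) (map_hopfKerComul ξ x)
      rw [AlgHom.comp_apply, AlgHom.comp_apply, AlgHom.comp_apply, h1, map_hopfKerComul]
      refine (h2 _).trans ?_
      rw [h3, map_hopfKerComul, Coalgebra.coassoc_apply])
    (by
      have hinj : Function.Injective ((hopfKerIncl ξ).lTensor k) :=
        Module.Flat.lTensor_preserves_injective_linearMap _ Subtype.val_injective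
      refine AlgHom.ext fun a => hinj ?_
      have h1 : ∀ x : hopfKer ξ ⊗[k] hopfKer ξ, (hopfKerIncl ξ).lTensor k
          (Algebra.TensorProduct.map ((counitAlgHom k A).comp (hopfKer ξ).val) (.id k _) x) =
          counit.rTensor A (Algebra.TensorProduct.map (hopfKer ξ).val (hopfKer ξ).val x) := by
        intro x
        induction x with
        | zero => simp
        | add x y hx hy => simp only [map_add, hx, hy]
        | tmul x y => simp
      rw [AlgHom.comp_apply, h1, map_hopfKerComul, Coalgebra.rTensor_counit_comul]
      simp)
    (by
      have hinj : Function.Injective ((hopfKerIncl ξ).rTensor k) :=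
        Module.Flat.rTensor_preserves_injective_linearMap _ Subtype.val_injective
      refine AlgHom.ext fun a => hinj ?_
      have h1 : ∀ x : hopfKer ξ ⊗[k] hopfKer ξ, (hopfKerIncl ξ).rTensor k
          (Algebra.TensorProduct.map (.id k _) ((counitAlgHom k A).comp (hopfKer ξ).val) x) =
          counit.lTensor A (Algebra.TensorProduct.map (hopfKer ξ).val (hopfKer ξ).val x) := by
        intro x
        induction x with
        | zero => simp
        | add x y hx hy => simp only [map_add, hx, hy]
        | tmul x y => simp
      rw [AlgHom.comp_apply, h1, map_hopfKerComul, Coalgebra.lTensor_counit_comul]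
      simp)

theorem map_comul_hopfKer (a : hopfKer ξ) :
    Algebra.TensorProduct.map (hopfKer ξ).val (hopfKer ξ).val (comul (R := k) a) =
      comul (R := k) (a : A) := map_hopfKerComul ξ a

theorem counit_hopfKer (a : hopfKer ξ) : counit (R := k) a = counit (R := k) (a : A) := rfl

instance : IsCocomm k (hopfKer ξ) where
  comm_comp_comul := by
    refine LinearMap.ext fun a => hopfKer_map_injective ξ ?_
    have h1 : ∀ x : hopfKer ξ ⊗[k] hopfKer ξ,
        Algebra.TensorProduct.map (hopfKer ξ).val (hopfKer ξ).val
          (TensorProduct.comm k _ _ x) = TensorProduct.comm k A A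
          (Algebra.TensorProduct.map (hopfKer ξ).val (hopfKer ξ).val x) := by
      intro x
      induction x with
      | zero => simp
      | add x y hx hy => simp only [map_add, hx, hy]
      | tmul x y => simp
    refine (h1 _).trans ?_
    rw [map_comul_hopfKer, comm_comul]

theorem antipode_mem {a : A} (ha : a ∈ hopfKer ξ) : antipode k a ∈ hopfKer ξ := by
  rw [mem_hopfKer] at ha ⊢
  have h1 : ∀ x : A ⊗[k] A, (ξ : A →ₗ[k] B).lTensor A
      (TensorProduct.map (antipode k) (antipode k) x) =
      TensorProduct.map (antipode k) (antipode k) ((ξ : A →ₗ[k] B).lTensor A x) := by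
    intro x
    induction x with
    | zero => simp
    | add x y hx hy => simp only [map_add, hx, hy]
    | tmul x y => simp [map_antipode]
  rw [comul_antipode, h1, ha]
  simp

instance : HopfAlgebra k (hopfKer ξ) :=
  HopfAlgebra.ofAlgHom
    (((antipodeAlgHom k A).comp (hopfKer ξ).val).codRestrict _ fun a => antipode_mem ξ a.2)
    (by
      refine AlgHom.ext fun a => Subtype.val_injective ?_
      have h1 : ∀ x : hopfKer ξ ⊗[k] hopfKer ξ, ((Algebra.TensorProduct.lift
          (((antipodeAlgHom k A).comp (hopfKer ξ).val).codRestrict (hopfKer ξ)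
            fun a => antipode_mem ξ a.2) (.id k (hopfKer ξ)) fun _ => Commute.all _) x : A) =
          LinearMap.mul' k A ((antipode k).rTensor A
            (Algebra.TensorProduct.map (hopfKer ξ).val (hopfKer ξ).val x)) := by
        intro x
        induction x with
        | zero => simp
        | add x y hx hy => simp only [map_add, hx, hy, Subalgebra.coe_add]
        | tmul x y => 
          refine (congrArg Subtype.val (Algebra.TensorProduct.lift_tmul ..)).trans ?_
          simp
          rfl
      refine (h1 _).trans ?_
      refine (congrArg (fun x => LinearMap.mul' k A ((antipode k).rTensor A x))
        (map_comul_hopfKer ξ a)).trans ?_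
      rw [mul_antipode_rTensor_comul_apply]
      rfl)
    (by
      refine AlgHom.ext fun a => Subtype.val_injective ?_
      have h1 : ∀ x : hopfKer ξ ⊗[k] hopfKer ξ, ((Algebra.TensorProduct.lift
          (.id k (hopfKer ξ)) (((antipodeAlgHom k A).comp (hopfKer ξ).val).codRestrict (hopfKer ξ)
            fun a => antipode_mem ξ a.2) fun _ _ => Commute.all _ _) x : A) =
          LinearMap.mul' k A ((antipode k).lTensor A
            (Algebra.TensorProduct.map (hopfKer ξ).val (hopfKer ξ).val x)) := by
        intro x
        induction x with
        | zero => simp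
        | add x y hx hy => simp only [map_add, hx, hy, Subalgebra.coe_add]
        | tmul x y => 
          refine (congrArg Subtype.val (Algebra.TensorProduct.lift_tmul ..)).trans ?_
          simp
          rfl
      refine (h1 _).trans ?_
      refine (congrArg (fun x => LinearMap.mul' k A ((antipode k).lTensor A x))
        (map_comul_hopfKer ξ a)).trans ?_
      rw [mul_antipode_lTensor_comul_apply]
      rfl)

/-- The kernel homomorphism `Ker_H(ξ) → A`. -/
def hopfKerHom : hopfKer ξ →ₐc[k] A :=
  .ofAlgHom (hopfKer ξ).val rfl (AlgHom.ext fun a => map_comul_hopfKer ξ a)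

/-- A homomorphism `φ : C → A` with `ξ ∘ φ = 1` factors through the kernel. -/
def hopfKerLift {C : Type*} [CommRing C] [HopfAlgebra k C] (φ : C →ₐc[k] A)
    (h : ∀ c, ξ (φ c) = algebraMap k B (counit c)) : C →ₐc[k] hopfKer ξ :=
  have hmem : ∀ c, φ c ∈ hopfKer ξ := by
    intro c
    have h1 : ∀ x : C ⊗[k] C, (ξ : A →ₗ[k] B).lTensor A
        (TensorProduct.map (φ : C →ₗ[k] A) (φ : C →ₗ[k] A) x) =
        TensorProduct.map (φ : C →ₗ[k] A) (Algebra.linearMap k B) (counit.lTensor C x) := by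
      intro x
      induction x with
      | zero => simp
      | add x y hx hy => simp only [map_add, hx, hy]
      | tmul x y => simp [h]
    rw [mem_hopfKer, ← CoalgHomClass.map_comp_comul_apply φ c, h1,
      Coalgebra.lTensor_counit_comul]
    simp
  .ofAlgHom ((φ : C →ₐ[k] A).codRestrict (hopfKer ξ) hmem)
    (AlgHom.ext fun c => CoalgHomClass.counit_comp_apply φ c)
    (AlgHom.ext fun c => hopfKer_map_injective ξ (by
      have h1 : ∀ x : C ⊗[k] C, Algebra.TensorProduct.map (hopfKer ξ).val (hopfKer ξ).val
          (Algebra.TensorProduct.map ((φ : C →ₐ[k] A).codRestrict (hopfKer ξ) hmem)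
            ((φ : C →ₐ[k] A).codRestrict (hopfKer ξ) hmem) x) =
          TensorProduct.map (φ : C →ₗ[k] A) (φ : C →ₗ[k] A) x := by
        intro x
        induction x with
        | zero => simp
        | add x y hx hy => simp only [map_add, hx, hy]
        | tmul x y =>
          simp
          rfl
      refine (h1 _).trans ?_
      refine Eq.trans ?_ (map_comul_hopfKer ξ _).symm
      exact CoalgHomClass.map_comp_comul_apply φ c))

@[simp] theorem coe_hopfKerLift {C : Type*} [CommRing C] [HopfAlgebra k C] (φ : C →ₐc[k] A)
    (h : ∀ c, ξ (φ c) = algebraMap k B (counit c)) (c : C) :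
    (hopfKerLift ξ φ h c : A) = φ c := rfl

theorem apply_of_mem_hopfKer {a : A} (ha : a ∈ hopfKer ξ) :
    ξ a = algebraMap k B (counit a) := by
  have h1 : ∀ x : A ⊗[k] A, (counit (R := k) (A := A)).rTensor B ((ξ : A →ₗ[k] B).lTensor A x) =
      (ξ : A →ₗ[k] B).lTensor k (counit.rTensor A x) := by
    intro x
    induction x with
    | zero => simp
    | add x y hx hy => simp only [map_add, hx, hy]
    | tmul x y => simp
  have h := h1 (comul a)
  rw [mem_hopfKer.1 ha, Coalgebra.rTensor_counit_comul] at h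
  have h2 := congrArg (TensorProduct.lid k B) h
  simp only [LinearMap.rTensor_tmul, LinearMap.lTensor_tmul, TensorProduct.lid_tmul, one_smul] at h2
  rw [Algebra.algebraMap_eq_smul_one]
  exact h2.symm

/-- The universal property of the kernel Hopf algebra. -/
theorem hopfKer_universal :
    (∀ a, ξ (hopfKerHom ξ a) = algebraMap k B (counit a)) ∧
    ∀ {C : Type*} [CommRing C] [HopfAlgebra k C] (φ : C →ₐc[k] A),
      (∀ c, ξ (φ c) = algebraMap k B (counit c)) →
        ∃! ψ : C →ₐc[k] hopfKer ξ, (hopfKerHom ξ).comp ψ = φ := by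
  refine ⟨fun a => apply_of_mem_hopfKer ξ a.2, fun φ h => ⟨hopfKerLift ξ φ h, ?_, ?_⟩⟩
  · exact BialgHom.ext fun c => rfl
  · intro ψ hψ
    refine BialgHom.ext fun c => Subtype.ext ?_
    exact DFunLike.congr_fun hψ c

end Kernel

section Cokernel

variable {k A B : Type*} [Field k] [CommRing A] [HopfAlgebra k A]
  [CommRing B] [HopfAlgebra k B]

/-- The ideal generated by the elements `ξ(a) - ε(a) 1`, equivalently the span of the elements
`ξ(a) b - ε(a) b`. -/
def hopfCokerIdeal (ξ : A →ₐc[k] B) : Ideal B :=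
  Ideal.span (Set.range fun a : A => ξ a - algebraMap k B (counit a))

variable (ξ : A →ₐc[k] B)

theorem hopfCokerIdeal_le {C : Type*} [CommRing C] [Algebra k C] (f : B →ₐ[k] C)
    (h : ∀ a, f (ξ a) = algebraMap k C (counit a)) {b : B} (hb : b ∈ hopfCokerIdeal ξ) :
    f b = 0 := by
  have : hopfCokerIdeal ξ ≤ RingHom.ker f := by
    refine Ideal.span_le.2 ?_
    rintro _ ⟨a, rfl⟩
    simp [RingHom.mem_ker, h]
  exact this hb

theorem mk_hopfCokerIdeal (a : A) :
    Ideal.Quotient.mk (hopfCokerIdeal ξ) (ξ a) =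
      algebraMap k (B ⧸ hopfCokerIdeal ξ) (counit a) :=
  Ideal.Quotient.eq.2 (Ideal.subset_span ⟨a, rfl⟩)

instance : (hopfCokerIdeal ξ).IsHopfIdeal k where
  counit_eq_zero x hx := hopfCokerIdeal_le ξ (counitAlgHom k B)
    (fun a => CoalgHomClass.counit_comp_apply ξ a) hx
  map_mkQ_comul_eq_zero x hx := by
    refine hopfCokerIdeal_le ξ ((Algebra.TensorProduct.map
      (Ideal.Quotient.mkₐ k (hopfCokerIdeal ξ)) (Ideal.Quotient.mkₐ k (hopfCokerIdeal ξ))).comp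
      (comulAlgHom k B)) (fun a => ?_) hx
    have h1 : ∀ x : A ⊗[k] A, Algebra.TensorProduct.map
        (Ideal.Quotient.mkₐ k (hopfCokerIdeal ξ)) (Ideal.Quotient.mkₐ k (hopfCokerIdeal ξ))
        (TensorProduct.map (ξ : A →ₗ[k] B) (ξ : A →ₗ[k] B) x) =
        TensorProduct.map (Algebra.linearMap k _) (Algebra.linearMap k _ ∘ₗ counit)
          (counit.rTensor A x) := by
      intro x
      induction x with
      | zero => simp
      | add x y hx hy => simp only [map_add, hx, hy]
      | tmul x y => simp [mk_hopfCokerIdeal]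
    rw [AlgHom.comp_apply, comulAlgHom_apply, ← CoalgHomClass.map_comp_comul_apply ξ a]
    refine (h1 _).trans ?_
    rw [Coalgebra.rTensor_counit_comul]
    simp [Algebra.TensorProduct.one_def, Algebra.algebraMap_eq_smul_one]
  antipode_mem x hx := by
    rw [← Ideal.Quotient.eq_zero_iff_mem]
    refine hopfCokerIdeal_le ξ ((Ideal.Quotient.mkₐ k (hopfCokerIdeal ξ)).comp
      (antipodeAlgHom k B)) (fun a => ?_) hx
    rw [AlgHom.comp_apply, antipodeAlgHom_apply, ← map_antipode]
    refine (mk_hopfCokerIdeal ξ _).trans ?_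
    rw [counit_antipode]

/-- The cokernel Hopf algebra of a homomorphism `ξ : A → B` of bicommutative Hopf algebras. -/
abbrev HopfCoker : Type _ := B ⧸ hopfCokerIdeal ξ

/-- The cokernel homomorphism `B → Cok_H(ξ)`. -/
def hopfCokerHom : B →ₐc[k] HopfCoker ξ := Bialgebra.Quotient.mkBialgHom _

theorem hopfCokerHom_surjective : Function.Surjective (hopfCokerHom ξ) :=
  Ideal.Quotient.mk_surjective

instance [IsCocomm k B] : IsCocomm k (HopfCoker ξ) where
  comm_comp_comul := by
    refine LinearMap.ext fun x => ?_
    obtain ⟨b, rfl⟩ := hopfCokerHom_surjective ξ x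
    rw [LinearMap.comp_apply, ← CoalgHomClass.map_comp_comul_apply (hopfCokerHom ξ) b]
    refine (TensorProduct.map_comm _ _ _).symm.trans ?_
    rw [comm_comul]

/-- The universal property of the cokernel Hopf algebra. -/
theorem hopfCoker_universal :
    (∀ a, hopfCokerHom ξ (ξ a) = algebraMap k (HopfCoker ξ) (counit a)) ∧
    ∀ {C : Type*} [CommRing C] [HopfAlgebra k C] (φ : B →ₐc[k] C),
      (∀ a, φ (ξ a) = algebraMap k C (counit a)) →
        ∃! ψ : HopfCoker ξ →ₐc[k] C, ψ.comp (hopfCokerHom ξ) = φ := by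
  refine ⟨mk_hopfCokerIdeal ξ, fun {C} _ _ φ h => ⟨BialgHom.ofAlgHom
    (Ideal.Quotient.liftₐ (hopfCokerIdeal ξ) (φ : B →ₐ[k] C)
      fun b hb => hopfCokerIdeal_le ξ (φ : B →ₐ[k] C) h hb) ?_ ?_, ?_, ?_⟩⟩
  · refine Ideal.Quotient.algHom_ext k (AlgHom.ext fun b => ?_)
    exact CoalgHomClass.counit_comp_apply φ b
  · refine Ideal.Quotient.algHom_ext k (AlgHom.ext fun b => ?_)
    refine Eq.trans ?_ (CoalgHomClass.map_comp_comul_apply φ b)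
    have h1 : ∀ x : B ⊗[k] B, Algebra.TensorProduct.map
      (Ideal.Quotient.liftₐ (hopfCokerIdeal ξ) (φ : B →ₐ[k] C)
        fun b hb => hopfCokerIdeal_le ξ (φ : B →ₐ[k] C) h hb)
      (Ideal.Quotient.liftₐ (hopfCokerIdeal ξ) (φ : B →ₐ[k] C)
        fun b hb => hopfCokerIdeal_le ξ (φ : B →ₐ[k] C) h hb)
      (TensorProduct.map (hopfCokerHom ξ : B →ₗ[k] _) (hopfCokerHom ξ : B →ₗ[k] _) x) =
        TensorProduct.map (φ : B →ₗ[k] _) (φ : B →ₗ[k] _) x := by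
      intro x
      induction x with
      | zero => simp
      | add x y hx hy => simp only [map_add, hx, hy]
      | tmul x y => rfl
    exact h1 _
  · exact BialgHom.ext fun c => rfl
  · intro ψ hψ
    refine BialgHom.ext fun x => ?_
    obtain ⟨b, rfl⟩ := hopfCokerHom_surjective ξ x
    exact DFunLike.congr_fun hψ b

end Cokernel

section Homology

variable {k A B C : Type*} [Field k] [CommRing A] [HopfAlgebra k A] [CommRing B] [HopfAlgebra k B]
  [IsCocomm k B] [CommRing C] [HopfAlgebra k C]

/-- The homology Hopf algebra `Cok_H(A → Ker_H(∂₋))` of a short chain complex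
`A → B → C` of bicommutative Hopf algebras. -/
abbrev HopfHomology (dp : A →ₐc[k] B) (dm : B →ₐc[k] C)
    (h : ∀ a, dm (dp a) = algebraMap k C (counit a)) : Type _ :=
  HopfCoker (hopfKerLift dm dp h)

end Homology

section Convolution

variable {k A B C : Type*} [CommRing k] [CommRing A] [Bialgebra k A] [CommRing B] [Bialgebra k B]
  [CommRing C] [Bialgebra k C]

theorem convMul_apply [IsCocomm k A] (f g : WithConv (A →ₐc[k] B)) (a : A) :
    (f * g) a = LinearMap.mul' k B
      (TensorProduct.map (f.ofConv : A →ₗ[k] B) (g.ofConv : A →ₗ[k] B) (comul a)) :=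
  congr($(BialgHom.toLinearMap_convMul f g) a)

/-- Postcomposition with `h` is a homomorphism of convolution monoids. -/
def convPost [IsCocomm k A] (h : B →ₐc[k] C) :
    WithConv (A →ₐc[k] B) →* WithConv (A →ₐc[k] C) where
  toFun f := toConv (h.comp f.ofConv)
  map_one' := WithConv.ofConv_injective (BialgHom.ext fun a => AlgHomClass.commutes h _)
  map_mul' f g := WithConv.ofConv_injective (BialgHom.ext fun a => by
    have h1 : ∀ x : A ⊗[k] A, h (LinearMap.mul' k B
        (TensorProduct.map (f.ofConv : A →ₗ[k] B) (g.ofConv : A →ₗ[k] B) x)) =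
        LinearMap.mul' k C (TensorProduct.map (h.comp f.ofConv : A →ₗ[k] C)
          (h.comp g.ofConv : A →ₗ[k] C) x) := by
      intro x
      induction x with
      | zero => simp
      | add x y hx hy => simp only [map_add, hx, hy]
      | tmul x y => simp
    refine (congrArg h (convMul_apply f g a)).trans ((h1 _).trans ?_)
    exact (convMul_apply (toConv (h.comp f.ofConv)) (toConv (h.comp g.ofConv)) a).symm)

/-- Precomposition with `h` is a homomorphism of convolution monoids. -/
def convPre [IsCocomm k A] [IsCocomm k B] (h : A →ₐc[k] B) :
    WithConv (B →ₐc[k] C) →* WithConv (A →ₐc[k] C) where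
  toFun f := toConv (f.ofConv.comp h)
  map_one' := WithConv.ofConv_injective (BialgHom.ext fun a =>
    congrArg (algebraMap k C) (CoalgHomClass.counit_comp_apply h a))
  map_mul' f g := WithConv.ofConv_injective (BialgHom.ext fun a => by
    have h1 : ∀ x : A ⊗[k] A, TensorProduct.map (f.ofConv : B →ₗ[k] C) (g.ofConv : B →ₗ[k] C)
        (TensorProduct.map (h : A →ₗ[k] B) (h : A →ₗ[k] B) x) =
        TensorProduct.map (f.ofConv.comp h : A →ₗ[k] C) (g.ofConv.comp h : A →ₗ[k] C) x := by
      intro x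
      induction x with
      | zero => simp
      | add x y hx hy => simp only [map_add, hx, hy]
      | tmul x y => simp
    refine (convMul_apply f g (h a)).trans ?_
    rw [← CoalgHomClass.map_comp_comul_apply h a, h1]
    exact (convMul_apply (toConv (f.ofConv.comp h)) (toConv (g.ofConv.comp h)) a).symm)

theorem convProd_comp [IsCocomm k A] [IsCocomm k B] {ι : Type*} (s : Finset ι) (h : A →ₐc[k] B)
    (f : ι → WithConv (B →ₐc[k] C)) : (∏ i ∈ s, f i).ofConv.comp h =
      (∏ i ∈ s, toConv ((f i).ofConv.comp h)).ofConv :=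
  congrArg ofConv (map_prod (convPre h) f s)

theorem comp_convProd [IsCocomm k A] {ι : Type*} (s : Finset ι) (h : B →ₐc[k] C)
    (f : ι → WithConv (A →ₐc[k] B)) : h.comp (∏ i ∈ s, f i).ofConv =
      (∏ i ∈ s, toConv (h.comp (f i).ofConv)).ofConv :=
  congrArg ofConv (map_prod (convPost h) f s)

end Convolution

section Matrix

variable {k A : Type*} [CommRing k] [CommRing A] [Bialgebra k A] [IsCocomm k A]
variable {m n : Type*} [Fintype m] [Fintype n]

/-- The homomorphism `a ↦ ⊗_i M_i(a^(i))`, the convolution product of the `M_i` followed by the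
inclusions of the tensor factors. -/
def colHom (M : m → (A →ₐc[k] A)) : A →ₐc[k] TensorPower k m A :=
  (∏ i, toConv ((incl k A i).comp (M i))).ofConv

variable (k m A) in
/-- The iterated comultiplication `a ↦ ⊗_i a^(i)`. -/
def iteratedComul : A →ₐc[k] TensorPower k m A := colHom fun _ => BialgHom.id k A

/-- The homomorphism `⨂_n A → ⨂_m A` of bicommutative Hopf algebras (the tensor product being the
biproduct) whose `(i, j)`-component is `M i j`. -/
def matrixHom (M : m → n → (A →ₐc[k] A)) : TensorPower k n A →ₐc[k] TensorPower k m A :=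
  liftHom fun j => colHom fun i => M i j

end Matrix

section Action

/-- An action of a ring `R` on a bicommutative bialgebra `A`: a unital ring homomorphism from `R`
to the endomorphisms of `A`, whose addition is convolution and whose multiplication is
composition. -/
structure RAction (R k A : Type*) [CommRing R] [CommRing k] [CommRing A] [HopfAlgebra k A]
    [IsCocomm k A] where
  /-- The endomorphism by which a ring element acts. -/
  toFun : R → (A →ₐc[k] A)
  map_one : toFun 1 = BialgHom.id k A
  map_mul : ∀ r s, toFun (r * s) = (toFun r).comp (toFun s)
  map_add : ∀ r s, toConv (toFun (r + s)) = toConv (toFun r) * toConv (toFun s)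

variable {R k A : Type*} [CommRing R] [CommRing k] [CommRing A] [HopfAlgebra k A]
    [IsCocomm k A]

instance : CoeFun (RAction R k A) fun _ => R → (A →ₐc[k] A) := ⟨RAction.toFun⟩

theorem RAction.map_zero (φ : RAction R k A) : toConv (φ 0) = 1 := by
  have h := φ.map_add 0 0
  rw [add_zero] at h
  have h2 := congrArg (fun f => toConv (f.ofConv : A →ₐ[k] A)) h
  have h3 : toConv ((φ 0 : A →ₐc[k] A) : A →ₐ[k] A) =
      toConv (φ 0 : A →ₐ[k] A) * toConv (φ 0 : A →ₐ[k] A) :=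
    h2.trans (BialgHom.toAlgHom_convMul (toConv (φ 0)) (toConv (φ 0)))
  have h4 := left_eq_mul.1 h3
  refine WithConv.ofConv_injective (BialgHom.ext fun a => ?_)
  exact DFunLike.congr_fun (congrArg ofConv h4) a

theorem RAction.map_sum (φ : RAction R k A) {ι : Type*} (s : Finset ι) (r : ι → R) :
    toConv (φ (∑ i ∈ s, r i)) = ∏ i ∈ s, toConv (φ (r i)) := by
  classical
  induction s using Finset.induction_on with
  | empty => simpa using φ.map_zero
  | insert i s hi ih => rw [Finset.sum_insert hi, Finset.prod_insert hi, φ.map_add, ih]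

end Action

universe u w

/-- A short abstract complex over `R`: three finite sets of cells with incidence numbers. -/
structure ShortAbstractComplex (R : Type u) [CommRing R] where
  /-- The `+`-cells. -/
  Plus : Type w
  /-- The `∘`-cells. -/
  Circ : Type w
  /-- The `-`-cells. -/
  Minus : Type w
  [fintypePlus : Fintype Plus]
  [fintypeCirc : Fintype Circ]
  [fintypeMinus : Fintype Minus]
  /-- The incidence numbers `[x₊ : x∘]`. -/
  incPlus : Plus → Circ → R
  /-- The incidence numbers `[x∘ : x₋]`. -/
  incMinus : Circ → Minus → R
  sum_inc : ∀ p m, ∑ c, incPlus p c * incMinus c m = 0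

attribute [instance] ShortAbstractComplex.fintypePlus ShortAbstractComplex.fintypeCirc
  ShortAbstractComplex.fintypeMinus

section ChainComplex

variable {R : Type u} [CommRing R] (X : ShortAbstractComplex.{u, w} R)
variable {k A : Type*} [CommRing k] [CommRing A] [HopfAlgebra k A] [IsCocomm k A]
variable (φ : RAction R k A)

/-- The boundary homomorphism `∂₊`, with `(x∘, x₊)`-component `φ([x₊ : x∘])`. -/
def boundaryPlus : TensorPower k X.Plus A →ₐc[k] TensorPower k X.Circ A :=
  matrixHom fun c p => φ (X.incPlus p c)

/-- The boundary homomorphism `∂₋`, with `(x₋, x∘)`-component `φ([x∘ : x₋])`. -/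
def boundaryMinus : TensorPower k X.Circ A →ₐc[k] TensorPower k X.Minus A :=
  matrixHom fun m c => φ (X.incMinus c m)

theorem boundary_comp (a : TensorPower k X.Plus A) :
    boundaryMinus X φ (boundaryPlus X φ a) = algebraMap k _ (counit a) := by
  have key : ∀ p : X.Plus, (boundaryMinus X φ).comp (colHom fun c => φ (X.incPlus p c)) =
      (1 : WithConv (A →ₐc[k] TensorPower k X.Minus A)).ofConv := by
    intro p
    rw [colHom, comp_convProd]
    congr 1
    have h1 : ∀ c : X.Circ, toConv ((boundaryMinus X φ).comp
        (toConv ((incl k A c).comp (φ (X.incPlus p c)))).ofConv) =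
        ∏ m, toConv ((incl k A m).comp (φ (X.incPlus p c * X.incMinus c m))) := by
      intro c
      apply WithConv.ofConv_injective
      have h2 : (boundaryMinus X φ).comp ((incl k A c).comp (φ (X.incPlus p c))) =
          (colHom fun m => φ (X.incMinus c m)).comp (φ (X.incPlus p c)) :=
        BialgHom.ext fun a => liftHom_incl _ c _
      refine h2.trans ?_
      rw [colHom, convProd_comp]
      congr 1
      refine Finset.prod_congr rfl fun m _ => ?_
      rw [mul_comm, φ.map_mul]
      rfl
    rw [Finset.prod_congr rfl fun c _ => h1 c, Finset.prod_comm]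
    refine Finset.prod_eq_one fun m _ => ?_
    have h2 := map_prod (convPost (A := A) (incl k A m))
      (fun c => toConv (φ (X.incPlus p c * X.incMinus c m))) Finset.univ
    refine h2.symm.trans ?_
    rw [← φ.map_sum, X.sum_inc, φ.map_zero, MonoidHom.map_one]
  have h3 : (((boundaryMinus X φ).comp (boundaryPlus X φ) : TensorPower k X.Plus A →ₐc[k] _) :
        TensorPower k X.Plus A →ₐ[k] TensorPower k X.Minus A) =
      (Algebra.ofId k _).comp (counitAlgHom k (TensorPower k X.Plus A)) := by
    refine algHom_ext' fun p a => ?_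
    refine (congrArg (boundaryMinus X φ) (liftHom_incl _ p a)).trans ?_
    refine (DFunLike.congr_fun (key p) a).trans ?_
    rw [AlgHom.comp_apply, counitAlgHom_apply, counit_incl]
    rfl
  exact DFunLike.congr_fun h3 a

end ChainComplex

section Integrals

variable (k : Type*) {A : Type*} [Field k] [CommRing A] [HopfAlgebra k A]

/-- A normalized integral: `σ a = a σ = ε(a) σ` for all `a`, and `ε(σ) = 1`. -/
structure IsNormalizedIntegral (σ : A) : Prop where
  mul_left : ∀ a, σ * a = counit (R := k) a • σ
  mul_right : ∀ a, a * σ = counit (R := k) a • σ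
  normalized : counit (R := k) σ = 1

/-- A normalized cointegral: `σ(a^(1)) a^(2) = a^(1) σ(a^(2)) = σ(a) 1` for all `a`, and
`σ(1) = 1`. -/
structure IsNormalizedCointegral (σ : A →ₗ[k] k) : Prop where
  comul_left : ∀ a, TensorProduct.lid k A (σ.rTensor A (comul a)) = σ a • (1 : A)
  comul_right : ∀ a, TensorProduct.rid k A (σ.lTensor A (comul a)) = σ a • (1 : A)
  normalized : σ 1 = 1

variable (A)

/-- Existence of a normalized integral and of a normalized cointegral. -/
def HasNormalizedIntegrals : Prop :=
  (∃ σ : A, IsNormalizedIntegral k σ) ∧ ∃ σ : A →ₗ[k] k, IsNormalizedCointegral k σ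

/-- A Hopf algebra is bisemisimple if it is semisimple (as an algebra) and cosemisimple (for
finite-dimensional Hopf algebras: the dual algebra, with the convolution product, is
semisimple). -/
structure IsBisemisimple : Prop where
  semisimple : IsSemisimpleRing A
  cosemisimple : IsSemisimpleRing (WithConv (A →ₗ[k] k))

/-- The normalized integral `σ_A` (unique if it exists). -/
def normalizedIntegral : A := Classical.epsilon fun σ : A => IsNormalizedIntegral k σ

/-- The normalized cointegral `σ^A` (unique if it exists). -/
def normalizedCointegral : A →ₗ[k] k :=
  Classical.epsilon fun σ : A →ₗ[k] k => IsNormalizedCointegral k σ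

/-- The number `vol⁻¹(A) = σ^A(σ_A)`. -/
def volInv : k := normalizedCointegral k A (normalizedIntegral k A)

/-- The symmetric Frobenius form `e_A(x, y) = vol⁻¹(A)⁻¹ σ^A(x y)`. -/
def frobeniusForm : A →ₗ[k] A →ₗ[k] k :=
  (volInv k A)⁻¹ • (LinearMap.mul k A).compr₂ (normalizedCointegral k A)

end Integrals

section Stabilizers

variable {R : Type u} [CommRing R] (X : ShortAbstractComplex.{u, w} R)
variable {k A : Type*} [Field k] [CommRing A] [HopfAlgebra k A] [IsCocomm k A]
variable (φ : RAction R k A)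

variable (k A) in
/-- The total space `V(X; A) = ⨂_{x∘} A`. -/
abbrev TotalSpace : Type _ := TensorPower k X.Circ A

/-- The `(+)`-stabilizer
`⊗ v_{x∘} ↦ ⊗ (φ([x₊ : x∘]) σ_A^(x∘)) v_{x∘}`, where `⊗ σ_A^(x∘)` is the iterated
comultiplication of the normalized integral. -/
def stabPlus (p : X.Plus) : Module.End k (TotalSpace X k A) :=
  LinearMap.mulLeft k (PiTensorProduct.map (fun c => (φ (X.incPlus p c) : A →ₗ[k] A))
    (iteratedComul k A X.Circ (normalizedIntegral k A)))

/-- The `(-)`-stabilizer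
`⊗ v_{x∘} ↦ σ^A(∏ φ([x∘ : x₋]) v_{x∘}^(2)) ⊗ v_{x∘}^(1)`. -/
def stabMinus (m : X.Minus) : Module.End k (TotalSpace X k A) :=
  (TensorProduct.rid k (TotalSpace X k A)).toLinearMap ∘ₗ
    (normalizedCointegral k A ∘ₗ
      (liftHom fun c => φ (X.incMinus c m) : TotalSpace X k A →ₗ[k] A)).lTensor _ ∘ₗ comul

/-- The elementary operator `∑_{x₊} (id - S⁺(x₊)) + ∑_{x₋} (id - S⁻(x₋))`. -/
def elementaryOperator : Module.End k (TotalSpace X k A) :=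
  ∑ p, (1 - stabPlus X φ p) + ∑ m, (1 - stabMinus X φ m)

/-- The space `V₀(X; A, φ)`, the kernel of the elementary operator. -/
abbrev groundSpace : Submodule k (TotalSpace X k A) := LinearMap.ker (elementaryOperator X φ)

/-- The kernel Hopf algebra of the boundary homomorphism `∂₋`. -/
abbrev Cycles : Subalgebra k (TotalSpace X k A) := hopfKer (boundaryMinus X φ)

/-- The homology Hopf algebra `H(X; A, φ)`. -/
def Homology : Type _ :=
  HopfHomology (boundaryPlus X φ) (boundaryMinus X φ) (boundary_comp X φ)

instance : CommRing (Homology X φ) :=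
  inferInstanceAs (CommRing (HopfHomology _ _ (boundary_comp X φ)))

instance : HopfAlgebra k (Homology X φ) :=
  inferInstanceAs (HopfAlgebra k (HopfHomology _ _ (boundary_comp X φ)))

instance : IsCocomm k (Homology X φ) :=
  inferInstanceAs (IsCocomm k (HopfHomology _ _ (boundary_comp X φ)))

/-- The canonical homomorphism `Ker_H(∂₋) → H(X; A, φ)`. -/
def homologyClass : Cycles X φ →ₐc[k] Homology X φ :=
  hopfCokerHom (hopfKerLift (boundaryMinus X φ) (boundaryPlus X φ) (boundary_comp X φ))

end Stabilizers

/-- The structure of a Hopf `*`-algebra on a commutative Hopf algebra over `ℂ`: an antilinear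
involutive anti-automorphism of the algebra that is compatible with the coalgebra structure. -/
structure HopfStar (A : Type*) [CommRing A] [HopfAlgebra ℂ A] where
  /-- The `*`-operation. -/
  star : A →ₛₗ[starRingEnd ℂ] A
  star_star : ∀ x, star (star x) = x
  star_one : star 1 = 1
  star_mul : ∀ x y, star (x * y) = star y * star x
  counit_star : ∀ x, counit (R := ℂ) (star x) = conj (counit (R := ℂ) x)
  comul_star : ∀ x, comul (R := ℂ) (star x) = TensorProduct.map star star (comul (R := ℂ) x)

/-- The Hermitian form `e*(v, w) = e(v*, w)` of a Hopf `*`-algebra, antilinear in the first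
and linear in the second argument. -/
def HopfStar.hermitianForm {A : Type*} [CommRing A] [HopfAlgebra ℂ A] (s : HopfStar A) :
    A →ₛₗ[starRingEnd ℂ] A →ₗ[ℂ] ℂ :=
  (frobeniusForm ℂ A).comp s.star

theorem HopfStar.map_mul {A : Type*} [CommRing A] [HopfAlgebra ℂ A] (s : HopfStar A)
    (x y : A ⊗[ℂ] A) : TensorProduct.map s.star s.star (x * y) =
      TensorProduct.map s.star s.star x * TensorProduct.map s.star s.star y := by
  induction x using TensorProduct.induction_on with
  | zero => simp
  | add x z hx hz => simp only [add_mul, map_add, hx, hz]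
  | tmul a b =>
    induction y using TensorProduct.induction_on with
    | zero => simp
    | add x z hx hz => simp only [mul_add, map_add, hx, hz]
    | tmul c d => simp [s.star_mul, mul_comm]

section Complexification

variable {R B : Type*} [CommRing R] [CommRing B] [HopfAlgebra ℝ B]

variable (B) in
/-- The complexification `B_ℂ = ℂ ⊗ B`. -/
abbrev Complexification : Type _ := ℂ ⊗[ℝ] B

/-- The antilinear map `λ ⊗ x ↦ conj λ ⊗ τ(x)`. -/
def complexStar (τ : B →ₐc[ℝ] B) : Complexification B →ₛₗ[starRingEnd ℂ] Complexification B where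
  toFun := TensorProduct.map (Complex.conjAe.toLinearMap : ℂ →ₗ[ℝ] ℂ) (τ : B →ₗ[ℝ] B)
  map_add' := _root_.map_add _
  map_smul' c x := by
    induction x using TensorProduct.induction_on with
    | zero => simp
    | add x y hx hy => simp only [smul_add, _root_.map_add, hx, hy]
    | tmul x y => simp [TensorProduct.smul_tmul']

@[simp] theorem complexStar_tmul (τ : B →ₐc[ℝ] B) (c : ℂ) (b : B) :
    complexStar τ (c ⊗ₜ[ℝ] b) = conj c ⊗ₜ[ℝ] τ b := rfl

/-- The complexification of a bicommutative Hopf algebra over `ℝ` with an involutive automorphism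
`τ` as a Hopf `*`-algebra. -/
def HopfStar.complexification (τ : B →ₐc[ℝ] B) (hτ : ∀ b, τ (τ b) = b) :
    HopfStar (Complexification B) where
  star := complexStar τ
  star_star x := by
    induction x using TensorProduct.induction_on with
    | zero => simp
    | add x y hx hy => simp only [_root_.map_add, hx, hy]
    | tmul x y => simp [hτ]
  star_one := by simp [Algebra.TensorProduct.one_def]
  star_mul x y := by
    induction x using TensorProduct.induction_on with
    | zero => simp
    | add x z hx hz => simp only [add_mul, mul_add, _root_.map_add, hx, hz]
    | tmul a b =>
      induction y using TensorProduct.induction_on with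
      | zero => simp
      | add x z hx hz => simp only [add_mul, mul_add, _root_.map_add, hx, hz]
      | tmul c d => simp [mul_comm]
  counit_star x := by
    induction x using TensorProduct.induction_on with
    | zero => simp
    | add x y hx hy => simp only [_root_.map_add, hx, hy]
    | tmul x y => simp
  comul_star x := by
    induction x using TensorProduct.induction_on with
    | zero => simp
    | add x y hx hy => simp only [_root_.map_add, hx, hy]
    | tmul x y =>
      rw [complexStar_tmul, TensorProduct.comul_tmul, TensorProduct.comul_tmul,
        ← CoalgHomClass.map_comp_comul_apply τ y]
      generalize comul (R := ℝ) y = z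
      induction z using TensorProduct.induction_on with
      | zero => simp only [TensorProduct.tmul_zero, LinearEquiv.map_zero, LinearMap.map_zero]
      | add x y hx hy => simp only [_root_.map_add, TensorProduct.tmul_add, hx, hy]
      | tmul y z => simp

variable [IsCocomm ℝ B]

/-- The complexification `ψ_ℂ(r) = id ⊗ ψ(r)` of an action. -/
def RAction.complexification (ψ : RAction R ℝ B) : RAction R ℂ (Complexification B) where
  toFun r := Bialgebra.TensorProduct.map (BialgHom.id ℂ ℂ) (ψ r)
  map_one := by
    refine BialgHom.ext fun x => ?_
    induction x using TensorProduct.induction_on with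
    | zero => simp
    | add x y hx hy => simp only [_root_.map_add, hx, hy]
    | tmul x y => simp [ψ.map_one]
  map_mul r s := by
    refine BialgHom.ext fun x => ?_
    induction x using TensorProduct.induction_on with
    | zero => simp
    | add x y hx hy => simp only [_root_.map_add, hx, hy]
    | tmul x y => simp [ψ.map_mul]
  map_add r s := by
    refine WithConv.ofConv_injective (BialgHom.ext fun x => ?_)
    refine Eq.trans ?_ (convMul_apply _ _ x).symm
    induction x using TensorProduct.induction_on with
    | zero => simp
    | add x y hx hy => simp only [_root_.map_add, hx, hy]
    | tmul x y =>
      have h : ψ (r + s) y = _ := (congr($(ψ.map_add r s) y)).trans (convMul_apply _ _ y)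
      refine (Bialgebra.TensorProduct.map_tmul (BialgHom.id ℂ ℂ) (ψ (r + s)) x y).trans ?_
      rw [h, TensorProduct.comul_tmul]
      generalize comul (R := ℝ) y = z
      induction z using TensorProduct.induction_on with
      | zero => simp only [TensorProduct.tmul_zero, LinearEquiv.map_zero, LinearMap.map_zero]
      | add x y hx hy => simp only [_root_.map_add, TensorProduct.tmul_add, hx, hy]
      | tmul y z => simp

theorem RAction.complexification_star (ψ : RAction R ℝ B) (τ : B →ₐc[ℝ] B)
    (hτ : ∀ b, τ (τ b) = b) (hψ : ∀ r b, ψ r (τ b) = τ (ψ r b)) (r : R)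
    (a : Complexification B) : ψ.complexification r ((HopfStar.complexification τ hτ).star a) =
      (HopfStar.complexification τ hτ).star (ψ.complexification r a) := by
  induction a using TensorProduct.induction_on with
  | zero => simp
  | add x y hx hy => simp only [_root_.map_add, hx, hy]
  | tmul x y => exact congrArg (conj x ⊗ₜ[ℝ] ·) (hψ r y)

end Complexification

section TensorStar

variable {A : Type*} [CommRing A] [HopfAlgebra ℂ A] (s : HopfStar A)
variable {ι : Type*} [Fintype ι]

/-- The complex conjugate of a complex vector space. -/
def ConjSpace (V : Type*) : Type _ := V

instance {V : Type*} [AddCommMonoid V] : AddCommMonoid (ConjSpace V) :=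
  inferInstanceAs (AddCommMonoid V)

instance {V : Type*} [AddCommMonoid V] [Module ℂ V] : Module ℂ (ConjSpace V) :=
  Module.compHom V (starRingEnd ℂ)

/-- The antilinear map on a tensor power induced by a map that is antilinear in each argument. -/
def antilift {V : Type*} [AddCommMonoid V] [Module ℂ V] (f : (ι → A) → V)
    (hadd : ∀ [DecidableEq ι] (v : ι → A) (i : ι) (x y : A),
      f (Function.update v i (x + y)) = f (Function.update v i x) + f (Function.update v i y))
    (hsmul : ∀ [DecidableEq ι] (v : ι → A) (i : ι) (c : ℂ) (x : A),
      f (Function.update v i (c • x)) = conj c • f (Function.update v i x)) :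
    TensorPower ℂ ι A →ₛₗ[starRingEnd ℂ] V :=
  let g : MultilinearMap ℂ (fun _ : ι => A) (ConjSpace V) :=
    { toFun := f
      map_update_add' := hadd
      map_update_smul' := hsmul }
  { toFun := PiTensorProduct.lift g
    map_add' := _root_.map_add (PiTensorProduct.lift g)
    map_smul' := _root_.map_smul (PiTensorProduct.lift g) }

theorem antilift_tprod {V : Type*} [AddCommMonoid V] [Module ℂ V] (f : (ι → A) → V) (hadd hsmul)
    (v : ι → A) : antilift f hadd hsmul (PiTensorProduct.tprod ℂ v) = f v :=
  PiTensorProduct.lift.tprod (E := ConjSpace V) v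

variable (ι) in
/-- The antilinear map `⊗ v_i ↦ ⊗ v_i*`. -/
def tensorStar : TensorPower ℂ ι A →ₛₗ[starRingEnd ℂ] TensorPower ℂ ι A :=
  antilift (fun v => PiTensorProduct.tprod ℂ fun i => s.star (v i))
    (fun v i x y => by
      have h : ∀ z, (fun j => s.star (Function.update v i z j)) =
          Function.update (fun j => s.star (v j)) i (s.star z) := fun z => by
        ext j
        exact Function.apply_update (fun _ => s.star) v i z j
      simp only [h, _root_.map_add]
      exact MultilinearMap.map_update_add _ _ _ _ _)
    (fun v i c x => by
      have h : ∀ z, (fun j => s.star (Function.update v i z j)) =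
          Function.update (fun j => s.star (v j)) i (s.star z) := fun z => by
        ext j
        exact Function.apply_update (fun _ => s.star) v i z j
      simp only [h, LinearMap.map_smulₛₗ]
      exact MultilinearMap.map_update_smul _ _ _ _ _)

@[simp] theorem tensorStar_tprod (v : ι → A) :
    tensorStar s ι (PiTensorProduct.tprod ℂ v) = PiTensorProduct.tprod ℂ fun i => s.star (v i) :=
  antilift_tprod _ _ _ v

theorem tensorStar_incl (i : ι) (a : A) :
    tensorStar s ι (inclAlg ℂ A i a) = inclAlg ℂ A i (s.star a) := by
  classical
  simp only [inclAlg, PiTensorProduct.singleAlgHom_apply, tensorStar_tprod,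
    MonoidHom.mulSingle_apply]
  congr 1
  ext j
  exact Pi.apply_mulSingle (fun _ => s.star) (fun _ => s.star_one) i a j

theorem tprod_eq_prod {k A : Type*} [CommRing k] [CommRing A] [Algebra k A] (v : ι → A) :
    PiTensorProduct.tprod k v = ∏ i, inclAlg k A i (v i) := by
  classical
  simp only [inclAlg, PiTensorProduct.singleAlgHom_apply, MonoidHom.mulSingle_apply]
  rw [← PiTensorProduct.tprod_prod]
  congr 1
  exact (Finset.univ_prod_mulSingle v).symm

theorem tensorStar_mul (x y : TensorPower ℂ ι A) :
    tensorStar s ι (x * y) = tensorStar s ι x * tensorStar s ι y := by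
  induction x using PiTensorProduct.induction_on with
  | add x z hx hz => simp only [add_mul, _root_.map_add, hx, hz]
  | smul_tprod c v =>
    induction y using PiTensorProduct.induction_on with
    | add x z hx hz => simp only [mul_add, _root_.map_add, hx, hz]
    | smul_tprod d w =>
      simp only [smul_mul_smul_comm, LinearMap.map_smulₛₗ, PiTensorProduct.tprod_mul_tprod,
        tensorStar_tprod, _root_.map_mul]
      congr 2
      ext i
      simp [s.star_mul, mul_comm]

theorem tensorStar_one : tensorStar s ι 1 = 1 := by
  rw [PiTensorProduct.one_def, tensorStar_tprod]
  congr 1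
  ext i
  exact s.star_one

/-- Two antilinear multiplicative maps on a tensor power agree if they agree on the tensor
factors. -/
theorem antilinear_ext {C : Type*} [CommRing C] [Algebra ℂ C]
    {f g : TensorPower ℂ ι A →ₛₗ[starRingEnd ℂ] C} (hf1 : f 1 = 1) (hg1 : g 1 = 1)
    (hf : ∀ x y, f (x * y) = f x * f y) (hg : ∀ x y, g (x * y) = g x * g y)
    (h : ∀ i a, f (inclAlg ℂ A i a) = g (inclAlg ℂ A i a)) (x : TensorPower ℂ ι A) :
    f x = g x := by
  induction x using PiTensorProduct.induction_on with
  | add x y hx hy => rw [_root_.map_add, _root_.map_add, hx, hy]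
  | smul_tprod c v =>
    rw [LinearMap.map_smulₛₗ, LinearMap.map_smulₛₗ, tprod_eq_prod]
    congr 1
    let F : TensorPower ℂ ι A →* C := ⟨⟨f, hf1⟩, hf⟩
    let G : TensorPower ℂ ι A →* C := ⟨⟨g, hg1⟩, hg⟩
    change F _ = G _
    rw [map_prod, map_prod]
    exact Finset.prod_congr rfl fun i _ => h i _

variable (ι) in
/-- The Hopf `*`-algebra structure on a tensor power. -/
def HopfStar.tensorPower : HopfStar (TensorPower ℂ ι A) where
  star := tensorStar s ι
  star_star x := by
    induction x using PiTensorProduct.induction_on with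
    | add x y hx hy => simp only [_root_.map_add, hx, hy]
    | smul_tprod c v => simp [s.star_star]
  star_one := tensorStar_one s
  star_mul x y := by rw [tensorStar_mul, mul_comm]
  counit_star x := by
    let e : ℂ →ₛₗ[starRingEnd ℂ] ℂ := (starRingEnd ℂ).toSemilinearMap
    refine antilinear_ext (f := (counit (R := ℂ)).comp (tensorStar s ι))
      (g := e.comp (counit (R := ℂ))) ?_ ?_ ?_ ?_ ?_ x
    · simp [tensorStar_one]
    · simp [e]
    · intro x y; simp [tensorStar_mul]
    · intro x y; simp [e]
    · intro i a
      simp [tensorStar_incl, counit_incl, s.counit_star, e]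
  comul_star x := by
    have h1 : ∀ x y : TensorPower ℂ ι A ⊗[ℂ] TensorPower ℂ ι A,
        TensorProduct.map (tensorStar s ι) (tensorStar s ι) (x * y) =
        TensorProduct.map (tensorStar s ι) (tensorStar s ι) x *
        TensorProduct.map (tensorStar s ι) (tensorStar s ι) y := by
      intro x y
      induction x using TensorProduct.induction_on with
      | zero => simp
      | add x z hx hz => simp only [add_mul, _root_.map_add, hx, hz]
      | tmul a b =>
        induction y using TensorProduct.induction_on with
        | zero => simp
        | add x z hx hz => simp only [mul_add, _root_.map_add, hx, hz]
        | tmul c d => simp [tensorStar_mul]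
    refine antilinear_ext (f := (comul (R := ℂ)).comp (tensorStar s ι))
      (g := (TensorProduct.map (tensorStar s ι) (tensorStar s ι)).comp (comul (R := ℂ)))
      ?_ ?_ ?_ ?_ ?_ x
    · simp [tensorStar_one]
    · simp [tensorStar_one, Algebra.TensorProduct.one_def]
    · intro x y; simp [tensorStar_mul]
    · intro x y; simp [h1]
    · intro i a
      simp only [LinearMap.comp_apply, tensorStar_incl, comul_incl, s.comul_star]
      generalize comul (R := ℂ) a = z
      induction z using TensorProduct.induction_on with
      | zero => simp
      | add x y hx hy => simp only [_root_.map_add, hx, hy]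
      | tmul a b => simp [tensorStar_incl]

end TensorStar

section HomologyStar

variable {A B : Type*} [CommRing A] [HopfAlgebra ℂ A] [CommRing B] [HopfAlgebra ℂ B]

/-- Homomorphisms commuting with the `*`-operations. -/
def StarCompat (s : HopfStar A) (t : HopfStar B) (f : A →ₐc[ℂ] B) : Prop :=
  ∀ a, f (s.star a) = t.star (f a)

theorem StarCompat.convProd [IsCocomm ℂ A] {s : HopfStar A} {t : HopfStar B} {ι : Type*}
    (u : Finset ι) (f : ι → WithConv (A →ₐc[ℂ] B)) (hf : ∀ i, StarCompat s t (f i).ofConv) :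
    StarCompat s t (∏ i ∈ u, f i).ofConv := by
  refine Finset.prod_induction f (fun g => StarCompat s t g.ofConv) ?_ ?_ fun i _ => hf i
  · intro f g hf hg a
    refine (convMul_apply f g _).trans (Eq.trans ?_ (congrArg t.star (convMul_apply f g a)).symm)
    rw [s.comul_star]
    generalize comul (R := ℂ) a = z
    induction z using TensorProduct.induction_on with
    | zero => simp
    | add x y hx hy => simp only [_root_.map_add, hx, hy]
    | tmul x y =>
      simp [t.star_mul, mul_comm, hf x, hg y]
  · intro a
    change algebraMap ℂ B (counit (s.star a)) = t.star (algebraMap ℂ B (counit a))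
    rw [s.counit_star, Algebra.algebraMap_eq_smul_one, Algebra.algebraMap_eq_smul_one,
      LinearMap.map_smulₛₗ, t.star_one]

theorem StarCompat.matrixHom [IsCocomm ℂ A] {s : HopfStar A} {m n : Type*} [Fintype m] [Fintype n]
    (M : m → n → (A →ₐc[ℂ] A)) (hM : ∀ i j, StarCompat s s (M i j)) :
    StarCompat (s.tensorPower n) (s.tensorPower m) (HopfComplex.matrixHom M) := by
  intro x
  refine antilinear_ext
    (f := (HopfComplex.matrixHom M : TensorPower ℂ n A →ₗ[ℂ] TensorPower ℂ m A).comp (s.tensorPower n).star)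
    (g := (s.tensorPower m).star.comp (HopfComplex.matrixHom M : TensorPower ℂ n A →ₗ[ℂ] TensorPower ℂ m A))
    ?_ ?_ ?_ ?_ ?_ x
  · simp [HopfStar.star_one]
  · simp [HopfStar.star_one]
  · intro x y; simp [HopfStar.star_mul, mul_comm]
  · intro x y; simp [HopfStar.star_mul, mul_comm]
  · intro j a
    have h : StarCompat s (s.tensorPower m) (colHom fun i => M i j) := by
      refine StarCompat.convProd _ _ fun i a => ?_
      refine (congrArg (inclAlg ℂ A i) (hM i j a)).trans ?_
      exact (tensorStar_incl s i _).symm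
    have h1 : ∀ a, HopfComplex.matrixHom M (inclAlg ℂ A j a) = colHom (fun i => M i j) a :=
      fun a => liftHom_incl _ j a
    have h2 : (s.tensorPower n).star (inclAlg ℂ A j a) = inclAlg ℂ A j (s.star a) :=
      tensorStar_incl s j a
    simp only [LinearMap.comp_apply, h2]
    refine (h1 _).trans ((h a).trans (congrArg _ (h1 a).symm))

variable [IsCocomm ℂ A]

theorem star_mem_hopfKer {s : HopfStar A} {t : HopfStar B} {ξ : A →ₐc[ℂ] B}
    (hξ : StarCompat s t ξ) {a : A} (ha : a ∈ hopfKer ξ) : s.star a ∈ hopfKer ξ := by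
  rw [mem_hopfKer] at ha ⊢
  have h1 : ∀ x : A ⊗[ℂ] A, (ξ : A →ₗ[ℂ] B).lTensor A (TensorProduct.map s.star s.star x) =
      TensorProduct.map s.star t.star ((ξ : A →ₗ[ℂ] B).lTensor A x) := by
    intro x
    induction x using TensorProduct.induction_on with
    | zero => simp
    | add x y hx hy => simp only [_root_.map_add, hx, hy]
    | tmul x y => simp [hξ y]
  rw [s.comul_star, h1, ha, TensorProduct.map_tmul, t.star_one]

/-- The kernel of a `*`-homomorphism as a Hopf `*`-algebra. -/
def HopfStar.ker {s : HopfStar A} {t : HopfStar B} {ξ : A →ₐc[ℂ] B} (hξ : StarCompat s t ξ) :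
    HopfStar (hopfKer ξ) where
  star :=
    { toFun := fun x => ⟨s.star x, star_mem_hopfKer hξ x.2⟩
      map_add' := fun x y => Subtype.ext (_root_.map_add s.star _ _)
      map_smul' := fun c x => Subtype.ext (LinearMap.map_smulₛₗ s.star c _) }
  star_star x := Subtype.ext (s.star_star x)
  star_one := Subtype.ext s.star_one
  star_mul x y := Subtype.ext (s.star_mul x y)
  counit_star x := s.counit_star x
  comul_star x := by
    refine hopfKer_map_injective ξ ?_
    refine (map_comul_hopfKer ξ _).trans ((s.comul_star x).trans ?_)
    rw [← map_comul_hopfKer]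
    generalize comul (R := ℂ) x = z
    induction z using TensorProduct.induction_on with
    | zero => simp
    | add x y hx hy => simp only [_root_.map_add, hx, hy]
    | tmul x y => rfl

theorem star_mem_hopfCokerIdeal {s : HopfStar A} {t : HopfStar B} {ξ : A →ₐc[ℂ] B}
    (hξ : StarCompat s t ξ) {b : B} (hb : b ∈ hopfCokerIdeal ξ) :
    t.star b ∈ hopfCokerIdeal ξ := by
  refine Submodule.span_induction ?_ ?_ ?_ ?_ hb
  · rintro _ ⟨a, rfl⟩
    refine Ideal.subset_span ⟨s.star a, ?_⟩
    change ξ (s.star a) - _ = t.star (ξ a - _)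
    rw [map_sub, hξ a, s.counit_star, Algebra.algebraMap_eq_smul_one,
      Algebra.algebraMap_eq_smul_one, LinearMap.map_smulₛₗ, t.star_one]
  · simp
  · intro x y _ _ hx hy
    rw [_root_.map_add]
    exact Ideal.add_mem _ hx hy
  · intro c x _ hx
    rw [smul_eq_mul, t.star_mul]
    exact Ideal.mul_mem_right _ _ hx

/-- The cokernel of a `*`-homomorphism as a Hopf `*`-algebra. -/
def HopfStar.coker {s : HopfStar A} {t : HopfStar B} {ξ : A →ₐc[ℂ] B} (hξ : StarCompat s t ξ) :
    HopfStar (HopfCoker ξ) where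
  star :=
    { toFun := Quotient.map' t.star fun x y h => by
        rw [Submodule.quotientRel_def] at h ⊢
        rw [← map_sub]
        exact star_mem_hopfCokerIdeal hξ h
      map_add' := fun x y => by
        obtain ⟨x, rfl⟩ := hopfCokerHom_surjective ξ x
        obtain ⟨y, rfl⟩ := hopfCokerHom_surjective ξ y
        exact congrArg (hopfCokerHom ξ) (_root_.map_add t.star x y)
      map_smul' := fun c x => by
        obtain ⟨x, rfl⟩ := hopfCokerHom_surjective ξ x
        exact (congrArg (hopfCokerHom ξ) (LinearMap.map_smulₛₗ t.star c x)).trans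
          (_root_.map_smul (hopfCokerHom ξ) _ _) }
  star_star x := by
    obtain ⟨x, rfl⟩ := hopfCokerHom_surjective ξ x
    exact congrArg (hopfCokerHom ξ) (t.star_star x)
  star_one := congrArg (hopfCokerHom ξ) t.star_one
  star_mul x y := by
    obtain ⟨x, rfl⟩ := hopfCokerHom_surjective ξ x
    obtain ⟨y, rfl⟩ := hopfCokerHom_surjective ξ y
    exact congrArg (hopfCokerHom ξ) (t.star_mul x y)
  counit_star x := by
    obtain ⟨x, rfl⟩ := hopfCokerHom_surjective ξ x
    exact t.counit_star x
  comul_star x := by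
    obtain ⟨x, rfl⟩ := hopfCokerHom_surjective ξ x
    refine (CoalgHomClass.map_comp_comul_apply (hopfCokerHom ξ) (t.star x)).symm.trans ?_
    rw [← CoalgHomClass.map_comp_comul_apply (hopfCokerHom ξ) x, t.comul_star]
    generalize comul (R := ℂ) x = z
    induction z using TensorProduct.induction_on with
    | zero => simp
    | add x y hx hy => simp only [_root_.map_add, hx, hy]
    | tmul x y => rfl

end HomologyStar

section SpaceStar

variable {R : Type u} [CommRing R] (X : ShortAbstractComplex.{u, w} R)
variable {A : Type*} [CommRing A] [HopfAlgebra ℂ A] [IsCocomm ℂ A]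

/-- The Hopf `*`-algebra structure on `V(X; A)`, given by the conjugate
`⊗ v_{x∘} ↦ ⊗ v_{x∘}*`. -/
def totalSpaceStar (s : HopfStar A) : HopfStar (TotalSpace X ℂ A) := s.tensorPower X.Circ

/-- The Hopf `*`-algebra structure on the homology `H(X; A, φ)` induced by that of `A`. -/
def homologyStar {s : HopfStar A} {φ : RAction R ℂ A} (hφ : ∀ r, StarCompat s s (φ r)) :
    HopfStar (Homology X φ) :=
  HopfStar.coker (s := s.tensorPower X.Plus)
    (t := HopfStar.ker (t := s.tensorPower X.Minus) (StarCompat.matrixHom _ fun _ _ => hφ _))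
    (ξ := hopfKerLift (boundaryMinus X φ) (boundaryPlus X φ) (boundary_comp X φ))
    (fun x => Subtype.ext (StarCompat.matrixHom (s := s)
      (fun c p => φ (X.incPlus p c)) (fun _ _ => hφ _) x))

end SpaceStar

end

end HopfComplex

open HopfComplex

/-! Everything reduces to traces. For a finite-dimensional bicommutative Hopf algebra `C` over a
field of characteristic zero, the trace of the regular representation is a cointegral
(`trace_comul`), so the normalized cointegral is the trace divided by the dimension. If a normalized
integral exists, multiplication by it is a projection of rank one, whence `σ^C(σ_C) = 1 / dim C`,
and the Frobenius form is the trace form `tr(x y)` (`frobeniusForm_apply`). Semisimplicity of `B`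
supplies the integral of `A`, and integrals pass to tensor powers, kernels and cokernels. Hermitian
symmetry comes from the uniqueness of the normalized cointegral.

The stabilizers are commuting self-adjoint idempotents. The operator `S⁺(x₊)` is multiplication by
an idempotent in the image of `∂₊` that is fixed by `*`. The operator `S⁻(x₋)` is the projection
`average` onto the kernel Hopf algebra of one row of `∂₋`. This projection is linear over that
kernel, which contains the image of `∂₊`, so the two kinds commute. A sum of commuting idempotents
is diagonalizable, its eigenvalues are natural numbers, and its kernel is the joint kernel. Since
the eigenvalues are real, orthogonality follows although the form may be indefinite.

Hence `V₀ = {v ∈ K | P v = v}` with the idempotent `P = ∂₊(σ ⊗ ⋯ ⊗ σ)` of `K`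
(`elementaryOperator_eq_zero_iff`). The kernel of `K → H` is the annihilator of `P`
(`hopfCokerHom_eq_zero_iff`), so `V₀ = P K` maps isomorphically to `H`. On `K` the trace of `V` is
`dim V / dim K` times the trace of `K` (`trace_hopfKer`), and the trace of `H` at `[v]` is that of
`K` at `v` when `P v = v` (`trace_hopfCoker`). The square root in `f` absorbs the ratio of
dimensions. -/

namespace HopfComplex

universe u w

open Coalgebra Bialgebra HopfAlgebra WithConv

noncomputable section

set_option linter.unusedSectionVars false

/-! ### The shear automorphism and the trace as a cointegral. -/

section Shear

variable {k C : Type*} [CommRing k] [CommRing C]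

/-- The `C`-linear algebra endomorphism `w ⊗ x ↦ w f(x^(1)) ⊗ x^(2)` of `C ⊗ C`. -/
def shear [Bialgebra k C] (f : C →ₐ[k] C) : C ⊗[k] C →ₐ[C] C ⊗[k] C :=
  Algebra.TensorProduct.lift (Algebra.ofId C (C ⊗[k] C))
    ((Algebra.TensorProduct.map f (.id k C)).comp (comulAlgHom k C)) fun _ _ => Commute.all _ _

theorem shear_tmul [Bialgebra k C] (f : C →ₐ[k] C) (w x : C) :
    shear f (w ⊗ₜ[k] x) = w • TensorProduct.map (f : C →ₗ[k] C) .id (comul (R := k) x) := by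
  rw [shear, Algebra.TensorProduct.lift_tmul, Algebra.smul_def]
  rfl

/-- By coassociativity the composite sends `1 ⊗ x` to `g(x^(1)) f(x^(2)) ⊗ x^(3)`, and the
hypothesis collapses the first two legs. Taking the identity and the antipode for `f` and `g`, in
either order, makes the shear invertible. -/
theorem shear_comp_shear [Bialgebra k C] (f g : C →ₐ[k] C)
    (h : ∀ x, LinearMap.mul' k C (TensorProduct.map (g : C →ₗ[k] C) (f : C →ₗ[k] C)
      (comul (R := k) x)) = algebraMap k C (counit x)) :
    (shear f).comp (shear g) = AlgHom.id C (C ⊗[k] C) := by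
  refine Algebra.TensorProduct.ext (by ext) (AlgHom.ext fun x => ?_)
  have h1 : ∀ z : C ⊗[k] C, shear f (TensorProduct.map (g : C →ₗ[k] C) .id z) =
      (LinearMap.mul' k C ∘ₗ TensorProduct.map (g : C →ₗ[k] C) (f : C →ₗ[k] C)).rTensor C
        ((TensorProduct.assoc k C C C).symm (comul.lTensor C z)) := by
    intro z
    induction z with
    | zero => simp
    | add x y hx hy => simp only [map_add, hx, hy]
    | tmul x y =>
      simp only [TensorProduct.map_tmul, shear_tmul, LinearMap.lTensor_tmul]
      generalize comul (R := k) y = z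
      induction z with
      | zero => simp
      | add x y hx hy => simp only [map_add, smul_add, TensorProduct.tmul_add, hx, hy]
      | tmul y z => simp [TensorProduct.smul_tmul']
  have h2 : ∀ z : C ⊗[k] C, (LinearMap.mul' k C ∘ₗ TensorProduct.map (g : C →ₗ[k] C)
      (f : C →ₗ[k] C)).rTensor C (comul.rTensor C z) =
      (Algebra.linearMap k C).rTensor C (counit.rTensor C z) := by
    intro z
    induction z with
    | zero => simp
    | add x y hx hy => simp only [map_add, hx, hy]
    | tmul x y => simp [h]
  change shear f (shear g (1 ⊗ₜ x)) = 1 ⊗ₜ x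
  rw [shear_tmul, one_smul, h1, Coalgebra.coassoc_symm_apply, h2, Coalgebra.rTensor_counit_comul]
  simp

variable [HopfAlgebra k C]

variable (k C) in
/-- The `C`-linear algebra automorphism `w ⊗ x ↦ w x^(1) ⊗ x^(2)` of `C ⊗ C`. -/
def shearEquiv : C ⊗[k] C ≃ₐ[C] C ⊗[k] C :=
  AlgEquiv.ofAlgHom (shear (.id k C)) (shear (antipodeAlgHom k C))
    (shear_comp_shear _ _ fun x => mul_antipode_rTensor_comul_apply x)
    (shear_comp_shear _ _ fun x => mul_antipode_lTensor_comul_apply x)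

theorem shearEquiv_one_tmul (x : C) : shearEquiv k C (1 ⊗ₜ x) = comul (R := k) x :=
  (shear_tmul _ _ _).trans ((one_smul C _).trans (LinearMap.congr_fun TensorProduct.map_id _))

/-- The trace form of a commutative Hopf algebra is an (unnormalized) cointegral. -/
theorem trace_comul [Module.Free k C] [Module.Finite k C] (a : C) :
    TensorProduct.rid k C ((Algebra.trace k C).lTensor C (comul a)) =
      Algebra.trace k C a • (1 : C) := by
  -- Over its left factor, `C ⊗ C` is the base change of `C`, so its trace is `id ⊗ tr`.
  have h1 : ∀ z : C ⊗[k] C, Algebra.trace C (C ⊗[k] C) z =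
      TensorProduct.rid k C ((Algebra.trace k C).lTensor C z) := by
    intro z
    induction z with
    | zero => simp
    | add x y hx hy => simp only [map_add, hx, hy]
    | tmul x y =>
      have h : Algebra.lmul C (C ⊗[k] C) (x ⊗ₜ y) =
          x • (Algebra.lmul k C y).baseChange C := by
        ext; simp [TensorProduct.smul_tmul']
      rw [Algebra.trace_apply, h, map_smul, LinearMap.trace_baseChange]
      simp [Algebra.trace_apply, Algebra.smul_def, mul_comm]
  -- `Δ(a)` is the image of `1 ⊗ a` under a `C`-algebra automorphism, so both have the same trace
  -- over `C`.
  rw [← h1, ← shearEquiv_one_tmul, Algebra.trace_eq_of_algEquiv, h1]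
  simp

end Shear

/-! ### Normalized integrals and cointegrals, and the Frobenius form as a trace form. -/

section Cointegral

variable {k C : Type*} [Field k] [CommRing C] [HopfAlgebra k C]

theorem lid_rTensor_comul [IsCocomm k C] (f : C →ₗ[k] k) (a : C) :
    TensorProduct.lid k C (f.rTensor C (comul a)) =
      TensorProduct.rid k C (f.lTensor C (comul a)) := by
  have h : ∀ z : C ⊗[k] C, TensorProduct.lid k C (f.rTensor C (TensorProduct.comm k C C z)) =
      TensorProduct.rid k C (f.lTensor C z) := by
    intro z
    induction z with
    | zero => simp
    | add x y hx hy => simp only [map_add, hx, hy]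
    | tmul x y => simp
  rw [← h, comm_comul]

theorem IsNormalizedCointegral.of_comul_right [IsCocomm k C] {σ : C →ₗ[k] k}
    (h : ∀ a, TensorProduct.rid k C (σ.lTensor C (comul a)) = σ a • (1 : C)) (h1 : σ 1 = 1) :
    IsNormalizedCointegral k σ :=
  ⟨fun a => (lid_rTensor_comul σ a).trans (h a), h, h1⟩

theorem IsNormalizedIntegral.of_mul_left {σ : C} (h : ∀ a, σ * a = counit (R := k) a • σ)
    (h1 : counit (R := k) σ = 1) : IsNormalizedIntegral k σ :=
  ⟨h, fun a => (mul_comm a σ).trans (h a), h1⟩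

theorem IsNormalizedIntegral.unique {σ σ' : C} (h : IsNormalizedIntegral k σ)
    (h' : IsNormalizedIntegral k σ') : σ = σ' := by
  have h1 := h.mul_left σ'
  rw [h'.mul_right, h.normalized, h'.normalized, one_smul, one_smul] at h1
  exact h1.symm

/-- Evaluate `σ ⊗ σ'` on `Δ(a)` by contracting either leg first: one order gives `σ'(a)`, the other
`σ(a)`. -/
theorem IsNormalizedCointegral.unique {σ σ' : C →ₗ[k] k} (h : IsNormalizedCointegral k σ)
    (h' : IsNormalizedCointegral k σ') : σ = σ' := by
  refine LinearMap.ext fun a => ?_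
  have h1 : ∀ z : C ⊗[k] C, σ (TensorProduct.rid k C (σ'.lTensor C z)) =
      σ' (TensorProduct.lid k C (σ.rTensor C z)) := by
    intro z
    induction z with
    | zero => simp
    | add x y hx hy => simp only [map_add, hx, hy]
    | tmul x y => simp [mul_comm]
  have h2 := h1 (comul a)
  rw [h'.comul_right, h.comul_left, map_smul, map_smul, h.normalized, h'.normalized] at h2
  simpa using h2.symm

theorem isNormalizedIntegral_normalizedIntegral (h : ∃ σ : C, IsNormalizedIntegral k σ) :
    IsNormalizedIntegral k (normalizedIntegral k C) := Classical.epsilon_spec h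

theorem IsNormalizedIntegral.eq {σ : C} (h : IsNormalizedIntegral k σ) :
    normalizedIntegral k C = σ :=
  (isNormalizedIntegral_normalizedIntegral ⟨σ, h⟩).unique h

theorem IsNormalizedCointegral.eq {σ : C →ₗ[k] k} (h : IsNormalizedCointegral k σ) :
    normalizedCointegral k C = σ :=
  IsNormalizedCointegral.unique (Classical.epsilon_spec (⟨σ, h⟩ :
    ∃ σ : C →ₗ[k] k, IsNormalizedCointegral k σ)) h

theorem IsNormalizedIntegral.mul_self {σ : C} (h : IsNormalizedIntegral k σ) : σ * σ = σ := by
  rw [h.mul_left, h.normalized, one_smul]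

theorem nontrivial_of_hopfAlgebra (k C : Type*) [Field k] [CommRing C] [HopfAlgebra k C] :
    Nontrivial C :=
  ⟨1, 0, fun h => by simpa using congrArg (counit (R := k)) h⟩

variable [CharZero k] [Module.Finite k C]

variable (k C) in
theorem finrank_cast_ne_zero : (Module.finrank k C : k) ≠ 0 := by
  have := nontrivial_of_hopfAlgebra k C
  exact Nat.cast_ne_zero.2 Module.finrank_pos.ne'

theorem isNormalizedCointegral_trace [IsCocomm k C] :
    IsNormalizedCointegral k ((Module.finrank k C : k)⁻¹ • Algebra.trace k C) := by
  refine .of_comul_right (fun a => ?_) ?_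
  · rw [LinearMap.lTensor_smul, LinearMap.smul_apply, map_smul, trace_comul]
    simp [smul_smul]
  · have h := Algebra.trace_algebraMap (S := C) (1 : k)
    rw [map_one, nsmul_one] at h
    rw [LinearMap.smul_apply, h, smul_eq_mul, inv_mul_cancel₀ (finrank_cast_ne_zero k C)]

variable [IsCocomm k C]

variable (k C) in
theorem normalizedCointegral_eq :
    normalizedCointegral k C = (Module.finrank k C : k)⁻¹ • Algebra.trace k C :=
  isNormalizedCointegral_trace.eq

variable (k C) in
theorem isNormalizedCointegral_normalizedCointegral :
    IsNormalizedCointegral k (normalizedCointegral k C) := by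
  rw [normalizedCointegral_eq]
  exact isNormalizedCointegral_trace

theorem trace_eq (a : C) :
    Algebra.trace k C a = Module.finrank k C * normalizedCointegral k C a := by
  rw [normalizedCointegral_eq, LinearMap.smul_apply, smul_eq_mul,
    mul_inv_cancel_left₀ (finrank_cast_ne_zero k C)]

/-- In characteristic zero a projection of trace zero vanishes, and the cointegral is a multiple of
the trace. This makes the normalizing scalar in `exists_integral_hopfKer` invertible. -/
theorem normalizedCointegral_ne_zero {p : C} (hp : p * p = p) (h0 : p ≠ 0) :
    normalizedCointegral k C p ≠ 0 := by
  intro h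
  have h1 := trace_eq (k := k) p
  rw [h, mul_zero, Algebra.trace_apply] at h1
  have h2 : IsIdempotentElem (Algebra.lmul k C p) := by
    rw [IsIdempotentElem, ← map_mul, hp]
  have h3 := LinearMap.congr_fun (LinearMap.IsIdempotentElem.eq_zero_of_trace_eq_zero h2 h1) 1
  exact h0 (by simpa using h3)

/-- Multiplication by the integral is the rank-one operator `a ↦ ε(a) σ`, whose trace is `ε(σ) = 1`.
-/
theorem volInv_eq (h : ∃ σ : C, IsNormalizedIntegral k σ) :
    volInv k C = (Module.finrank k C : k)⁻¹ := by
  have hσ := isNormalizedIntegral_normalizedIntegral h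
  have h1 : Algebra.lmul k C (normalizedIntegral k C) =
      (counit (R := k) (A := C)).smulRight (normalizedIntegral k C) :=
    LinearMap.ext hσ.mul_left
  rw [volInv, normalizedCointegral_eq, LinearMap.smul_apply, Algebra.trace_apply, h1,
    LinearMap.trace_smulRight, hσ.normalized, smul_eq_mul, mul_one]

/-- The Frobenius form of a Hopf algebra with a normalized integral is its trace form. -/
theorem frobeniusForm_apply (h : ∃ σ : C, IsNormalizedIntegral k σ) (x y : C) :
    frobeniusForm k C x y = Algebra.trace k C (x * y) := by
  rw [trace_eq, frobeniusForm, volInv_eq h, inv_inv]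
  rfl

end Cointegral

/-! ### The projection onto a kernel Hopf algebra. -/

section Average

variable {k A B : Type*} [Field k] [CommRing A] [HopfAlgebra k A] [IsCocomm k A]
  [CommRing B] [HopfAlgebra k B]

/-- The map `a ↦ σ(g(a^(2))) a^(1)`, a projection onto the kernel Hopf algebra of `g` if `σ` is a
normalized cointegral. -/
def average (g : A →ₐc[k] B) (σ : B →ₗ[k] k) : A →ₗ[k] A :=
  (TensorProduct.rid k A).toLinearMap ∘ₗ (σ ∘ₗ (g : A →ₗ[k] B)).lTensor _ ∘ₗ comul

variable {g : A →ₐc[k] B} {σ : B →ₗ[k] k}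

theorem average_eq (a : A) : average g σ a =
    TensorProduct.rid k A (σ.lTensor A ((g : A →ₗ[k] B).lTensor A (comul a))) := by
  rw [← LinearMap.lTensor_comp_apply]
  rfl

/-- Coassociativity: both sides are `a^(1) ⊗ a^(2) σ(g(a^(3)))`. The average only contracts the last
leg, so it is a map of left comodules. -/
theorem comul_average (a : A) :
    comul (R := k) (average g σ a) = (average g σ).lTensor A (comul a) := by
  have h : ∀ z : A ⊗[k] A,
      comul (R := k) (TensorProduct.rid k A ((σ ∘ₗ (g : A →ₗ[k] B)).lTensor A z)) =
      ((TensorProduct.rid k A).toLinearMap ∘ₗ (σ ∘ₗ (g : A →ₗ[k] B)).lTensor _).lTensor A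
        (TensorProduct.assoc k A A A (comul.rTensor A z)) := by
    intro z
    induction z with
    | zero => simp
    | add x y hx hy => simp only [map_add, hx, hy]
    | tmul x y =>
      simp only [LinearMap.lTensor_tmul, LinearMap.rTensor_tmul, TensorProduct.rid_tmul, map_smul]
      generalize comul (R := k) x = z
      induction z with
      | zero => simp
      | add x y hx hy => simp only [map_add, smul_add, TensorProduct.add_tmul, hx, hy]
      | tmul x z => simp
  refine (h _).trans ?_
  rw [Coalgebra.coassoc_apply, ← LinearMap.lTensor_comp_apply]
  rfl

theorem average_mem (hσ : IsNormalizedCointegral k σ) (a : A) : average g σ a ∈ hopfKer g := by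
  -- Since `g` is a coalgebra map, this is the cointegral property of `σ` at `g(x)`. Applied to the
  -- second leg of `Δ(average a)`, it puts a `1` there.
  have h1 : ∀ x, g (average g σ x) = σ (g x) • (1 : B) := by
    intro x
    have h : ∀ z : A ⊗[k] A, g (TensorProduct.rid k A ((σ ∘ₗ (g : A →ₗ[k] B)).lTensor A z)) =
        TensorProduct.rid k B (σ.lTensor B (TensorProduct.map (g : A →ₗ[k] B) (g : A →ₗ[k] B) z)) := by
      intro z
      induction z with
      | zero => simp
      | add x y hx hy => simp only [map_add, hx, hy]
      | tmul x y => simp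
    refine (h _).trans ?_
    rw [CoalgHomClass.map_comp_comul_apply g x, hσ.comul_right]
  have h2 : ∀ z : A ⊗[k] A, (g : A →ₗ[k] B).lTensor A ((average g σ).lTensor A z) =
      TensorProduct.rid k A ((σ ∘ₗ (g : A →ₗ[k] B)).lTensor A z) ⊗ₜ[k] (1 : B) := by
    intro z
    induction z with
    | zero => simp
    | add x y hx hy => simp only [map_add, TensorProduct.add_tmul, hx, hy]
    | tmul x y => simp [h1, TensorProduct.smul_tmul]
  rw [mem_hopfKer, comul_average, h2]
  rfl

theorem average_of_mem (hσ : IsNormalizedCointegral k σ) {a : A} (ha : a ∈ hopfKer g) :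
    average g σ a = a := by
  rw [average_eq, mem_hopfKer.1 ha]
  simp [hσ.normalized]

/-- After `id ⊗ g`, the coproduct of a kernel element is `a ⊗ 1`, so `a` can be pulled out. This
linearity over the kernel gives self-adjointness, the integral of the kernel, and the commutation
with the `(+)`-stabilizers. -/
theorem average_mul_of_mem {a : A} (ha : a ∈ hopfKer g) (b : A) :
    average g σ (a * b) = a * average g σ b := by
  have h1 : (g : A →ₗ[k] B).lTensor A (comul (a * b)) =
      (a ⊗ₜ[k] (1 : B)) * (g : A →ₗ[k] B).lTensor A (comul b) := by
    rw [← mem_hopfKer.1 ha, Bialgebra.comul_mul]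
    exact map_mul (Algebra.TensorProduct.map (.id k A) (g : A →ₐ[k] B)) _ _
  have h2 : ∀ z : A ⊗[k] B, TensorProduct.rid k A (σ.lTensor A ((a ⊗ₜ[k] (1 : B)) * z)) =
      a * TensorProduct.rid k A (σ.lTensor A z) := by
    intro z
    induction z with
    | zero => simp
    | add x y hx hy => simp only [map_add, mul_add, hx, hy]
    | tmul x y => simp
  rw [average_eq, average_eq, h1, h2]

theorem average_average (hσ : IsNormalizedCointegral k σ) (a : A) :
    average g σ (average g σ a) = average g σ a :=
  average_of_mem hσ (average_mem hσ a)

/-- Both sides are `l(a^(1)) σ(g(a^(2)))`. It is used with `l` the counit and with `l` a cointegral.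
-/
theorem apply_average (l : A →ₗ[k] k) (a : A) :
    l (average g σ a) = σ (g (TensorProduct.lid k A (l.rTensor A (comul a)))) := by
  have h : ∀ z : A ⊗[k] A, l (TensorProduct.rid k A ((σ ∘ₗ (g : A →ₗ[k] B)).lTensor A z)) =
      σ (g (TensorProduct.lid k A (l.rTensor A z))) := by
    intro z
    induction z with
    | zero => simp
    | add x y hx hy => simp only [map_add, hx, hy]
    | tmul x y => simp [mul_comm]
  exact h _

theorem counit_average (a : A) : counit (R := k) (average g σ a) = σ (g a) := by
  rw [apply_average, Coalgebra.rTensor_counit_comul]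
  simp

theorem cointegral_average (hσ : IsNormalizedCointegral k σ) {l : A →ₗ[k] k}
    (hl : IsNormalizedCointegral k l) (a : A) : l (average g σ a) = l a := by
  rw [apply_average, hl.comul_left]
  simp [hσ.normalized]

/-- The projection onto a kernel Hopf algebra is self-adjoint. -/
theorem cointegral_average_mul (hσ : IsNormalizedCointegral k σ) {l : A →ₗ[k] k}
    (hl : IsNormalizedCointegral k l) (a b : A) :
    l (average g σ a * b) = l (a * average g σ b) := by
  -- The cointegral does not see averaging, so both sides become `l` of the product of the two
  -- averages.
  rw [← cointegral_average (g := g) hσ hl, average_mul_of_mem (average_mem hσ a),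
    ← cointegral_average (g := g) hσ hl (a * _), mul_comm a,
    average_mul_of_mem (average_mem hσ b), mul_comm]

/-- By cocommutativity the second average may contract the first leg instead of the last, and
contractions of opposite legs commute. -/
theorem average_comm {B' : Type*} [CommRing B'] [HopfAlgebra k B'] (g : A →ₐc[k] B)
    (σ : B →ₗ[k] k) (g' : A →ₐc[k] B') (σ' : B' →ₗ[k] k) :
    average g σ * average g' σ' = average g' σ' * average g σ := by
  refine LinearMap.ext fun a => ?_
  have h1 : ∀ x, average g' σ' x =
      TensorProduct.lid k A ((σ' ∘ₗ (g' : A →ₗ[k] B')).rTensor A (comul x)) :=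
    fun x => (lid_rTensor_comul _ x).symm
  have h2 : ∀ z : A ⊗[k] A, average g σ (TensorProduct.lid k A
        ((σ' ∘ₗ (g' : A →ₗ[k] B')).rTensor A z)) = TensorProduct.lid k A
        ((σ' ∘ₗ (g' : A →ₗ[k] B')).rTensor A ((average g σ).lTensor A z)) := by
    intro z
    induction z with
    | zero => simp
    | add x y hx hy => simp only [map_add, hx, hy]
    | tmul x y => simp
  rw [Module.End.mul_apply, Module.End.mul_apply, h1, h1, h2, comul_average]

end Average

/-! ### Integral, cointegral and trace of a kernel Hopf algebra. -/

section Kernel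

variable {k A B : Type*} [Field k] [CharZero k] [CommRing A] [HopfAlgebra k A] [IsCocomm k A]
  [CommRing B] [HopfAlgebra k B]

theorem IsNormalizedIntegral.map_mul_self {σ : A} (hσ : IsNormalizedIntegral k σ)
    (g : A →ₐc[k] B) : g σ * g σ = g σ := by
  rw [← map_mul, hσ.mul_self]

theorem IsNormalizedIntegral.map_ne_zero {σ : A} (hσ : IsNormalizedIntegral k σ)
    (g : A →ₐc[k] B) : g σ ≠ 0 := by
  intro h
  have h1 := CoalgHomClass.counit_comp_apply g σ
  rw [h, hσ.normalized, map_zero] at h1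
  exact zero_ne_one h1

theorem IsNormalizedIntegral.map {σ : A} (hσ : IsNormalizedIntegral k σ)
    {g : A →ₐc[k] B} (hg : Function.Surjective g) : IsNormalizedIntegral k (g σ) := by
  refine .of_mul_left (fun b => ?_) ((CoalgHomClass.counit_comp_apply g σ).trans hσ.normalized)
  obtain ⟨a, rfl⟩ := hg b
  rw [← map_mul, hσ.mul_left, map_smul, CoalgHomClass.counit_comp_apply]

/-- The kernel Hopf algebra has a normalized integral. -/
theorem exists_integral_hopfKer [IsCocomm k B] [Module.Finite k B] (g : A →ₐc[k] B)
    (h : ∃ σ : A, IsNormalizedIntegral k σ) : ∃ σ : hopfKer g, IsNormalizedIntegral k σ := by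
  obtain ⟨σ, hσ⟩ := h
  have hl := isNormalizedCointegral_normalizedCointegral k B
  -- The average of `σ` has counit `σ^B(g σ)`, by which it must be divided. This is nonzero because
  -- `g σ` is a nonzero idempotent.
  have h0 := normalizedCointegral_ne_zero (k := k) (hσ.map_mul_self g) (hσ.map_ne_zero g)
  refine ⟨(normalizedCointegral k B (g σ))⁻¹ • ⟨average g (normalizedCointegral k B) σ,
    average_mem hl σ⟩, .of_mul_left (fun a => Subtype.ext ?_) ?_⟩
  · change (_ • average g (normalizedCointegral k B) σ) * (a : A) =
      counit (R := k) (a : A) • _ • average g (normalizedCointegral k B) σ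
    rw [smul_mul_assoc, mul_comm, ← average_mul_of_mem a.2, hσ.mul_right, map_smul, smul_comm]
  · rw [map_smul]
    refine (congrArg _ (counit_average (g := g) σ)).trans ?_
    rw [smul_eq_mul, inv_mul_cancel₀ h0]

/-- The normalized cointegral of a kernel Hopf algebra is the restriction. -/
theorem normalizedCointegral_hopfKer [Module.Finite k A] (g : A →ₐc[k] B) (a : hopfKer g) :
    normalizedCointegral k (hopfKer g) a = normalizedCointegral k A (a : A) := by
  have hl := isNormalizedCointegral_normalizedCointegral k A
  have h : IsNormalizedCointegral k (normalizedCointegral k A ∘ₗ hopfKerIncl g) := by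
    refine .of_comul_right (fun a => Subtype.ext ?_) hl.normalized
    have h1 : ∀ z : hopfKer g ⊗[k] hopfKer g,
        ((TensorProduct.rid k (hopfKer g)
          ((normalizedCointegral k A ∘ₗ hopfKerIncl g).lTensor (hopfKer g) z) : hopfKer g) : A) =
        TensorProduct.rid k A ((normalizedCointegral k A).lTensor A
          (Algebra.TensorProduct.map (hopfKer g).val (hopfKer g).val z)) := by
      intro z
      induction z with
      | zero => simp
      | add x y hx hy => simp only [map_add, hx, hy, Subalgebra.coe_add]
      | tmul x y => simp
    rw [h1, map_comul_hopfKer, hl.comul_right]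
    rfl
  rw [h.eq]
  rfl

/-- The normalized cointegrals agree on the kernel, and each trace is its dimension times the
cointegral. This ratio is the origin of the square root in the isometry. -/
theorem trace_hopfKer [Module.Finite k A] (g : A →ₐc[k] B) (a : hopfKer g) :
    Algebra.trace k A (a : A) = (Module.finrank k A / Module.finrank k (hopfKer g) : k) *
      Algebra.trace k (hopfKer g) a := by
  rw [trace_eq, trace_eq, normalizedCointegral_hopfKer, ← mul_assoc,
    div_mul_cancel₀ _ (finrank_cast_ne_zero k (hopfKer g))]

end Kernel

/-! ### The cokernel and the idempotent given by the image of the integral. -/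

section Cokernel

variable {k A B : Type*} [Field k] [CommRing A] [HopfAlgebra k A]
  [CommRing B] [HopfAlgebra k B] (ξ : A →ₐc[k] B) {σ : A}

theorem hopfCokerHom_integral (hσ : IsNormalizedIntegral k σ) : hopfCokerHom ξ (ξ σ) = 1 := by
  refine (mk_hopfCokerIdeal ξ σ).trans ?_
  rw [hσ.normalized, map_one]

/-- The kernel of the cokernel homomorphism is the annihilator of the image of the integral. -/
theorem hopfCokerHom_eq_zero_iff (hσ : IsNormalizedIntegral k σ) (b : B) :
    hopfCokerHom ξ b = 0 ↔ ξ σ * b = 0 := by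
  constructor
  · intro h
    refine Submodule.span_induction (p := fun b _ => ξ σ * b = 0) ?_ (mul_zero _) ?_ ?_
      (Ideal.Quotient.eq_zero_iff_mem.1 h)
    · rintro _ ⟨a, rfl⟩
      rw [mul_sub, ← map_mul, hσ.mul_left, map_smul, mul_comm, Algebra.smul_def, sub_self]
    · intro x y _ _ hx hy
      rw [mul_add, hx, hy, add_zero]
    · intro c x _ hx
      rw [smul_eq_mul, mul_left_comm, hx, mul_zero]
  -- The quotient map sends `ξ σ` to `1`, so whatever `ξ σ` annihilates becomes zero.
  · intro h
    have h1 := congrArg (hopfCokerHom ξ) h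
    rwa [map_mul, hopfCokerHom_integral ξ hσ, one_mul, map_zero] at h1

/-- As `b = ξ σ * b` annihilates the kernel of the quotient map `π`, multiplication by `b` factors
as `(b s) ∘ π` for a linear section `s`. Cyclicity of the trace replaces it by `π ∘ (b s)`, which is
multiplication by `π b`. -/
theorem trace_hopfCoker [Module.Finite k B] (hσ : IsNormalizedIntegral k σ) {b : B}
    (hb : ξ σ * b = b) :
    Algebra.trace k (HopfCoker ξ) (hopfCokerHom ξ b) = Algebra.trace k B b := by
  obtain ⟨s, hs⟩ := LinearMap.exists_rightInverse_of_surjective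
    (hopfCokerHom ξ : B →ₗ[k] HopfCoker ξ)
    (LinearMap.range_eq_top.2 (hopfCokerHom_surjective ξ))
  have hs' : ∀ x, hopfCokerHom ξ (s x) = x := LinearMap.congr_fun hs
  have h1 : Algebra.lmul k B b = (LinearMap.mulLeft k b ∘ₗ s) ∘ₗ
      (hopfCokerHom ξ : B →ₗ[k] HopfCoker ξ) := by
    refine LinearMap.ext fun x => ?_
    have h2 : ξ σ * (x - s (hopfCokerHom ξ x)) = 0 := by
      rw [← hopfCokerHom_eq_zero_iff ξ hσ, map_sub, hs', sub_self]
    change b * x = b * s (hopfCokerHom ξ x)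
    rw [← sub_eq_zero, ← mul_sub, ← hb, mul_right_comm, h2, zero_mul]
  have h2 : (hopfCokerHom ξ : B →ₗ[k] HopfCoker ξ) ∘ₗ (LinearMap.mulLeft k b ∘ₗ s) =
      Algebra.lmul k (HopfCoker ξ) (hopfCokerHom ξ b) := by
    refine LinearMap.ext fun x => ?_
    change hopfCokerHom ξ (b * s x) = hopfCokerHom ξ b * x
    rw [map_mul, hs']
  rw [Algebra.trace_apply, Algebra.trace_apply, h1, LinearMap.trace_comp_comm', h2]

end Cokernel

/-! ### The integral of a tensor power. -/

section TensorPower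

variable {k A ι : Type*} [Field k] [CommRing A] [HopfAlgebra k A] [Fintype ι]

theorem counit_tprod (v : ι → A) : counit (R := k) (PiTensorProduct.tprod k v) =
    ∏ i, counit (R := k) (v i) := by
  rw [tprod_eq_prod, ← counitAlgHom_apply k, map_prod]
  exact Finset.prod_congr rfl fun i _ => counit_incl i _

theorem IsNormalizedIntegral.tprod {σ : A} (hσ : IsNormalizedIntegral k σ) :
    IsNormalizedIntegral k (PiTensorProduct.tprod k fun _ : ι => σ) := by
  refine .of_mul_left (fun x => ?_) (by simp [counit_tprod, hσ.normalized])
  induction x using PiTensorProduct.induction_on with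
  | add x y hx hy => rw [mul_add, hx, hy, map_add, add_smul]
  | smul_tprod c v =>
    rw [mul_smul_comm, PiTensorProduct.tprod_mul_tprod, map_smul, counit_tprod, smul_assoc,
      ← MultilinearMap.map_smul_univ]
    congr 2
    exact funext fun i => hσ.mul_left _

end TensorPower

/-! ### Sums of commuting idempotents. -/

section CommutingIdempotents

variable {k V ι : Type*} [Field k] [CharZero k] [AddCommGroup V] [Module k V]
  {q : ι → Module.End k V}

/-- On a joint eigenspace of the `q i`, the operator `c + ∑ q i` acts as `c + n` for a natural
number `n`, hence invertibly. The induction avoids simultaneous diagonalization. -/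
theorem eq_zero_of_smul_add_sum_idempotent (hq : ∀ i, q i * q i = q i)
    (hc : ∀ i j, q i * q j = q j * q i) (s : Finset ι) {c : k} (h0 : ∀ n : ℕ, c + n ≠ 0) {v : V}
    (h : c • v + (∑ i ∈ s, q i) v = 0) : v = 0 := by
  classical
  induction s using Finset.induction_on generalizing c v with
  | empty =>
    have h1 := h0 0
    rw [Nat.cast_zero, add_zero] at h1
    simpa [h1] using h
  | insert i s hi ih =>
    rw [Finset.sum_insert hi, LinearMap.add_apply] at h
    have hcomm : q i ((∑ j ∈ s, q j) v) = (∑ j ∈ s, q j) (q i v) := by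
      rw [← Module.End.mul_apply, Finset.mul_sum, ← Module.End.mul_apply, Finset.sum_mul]
      simp only [hc i]
    have h1 : q i v = 0 := by
      -- On the range of the idempotent `q i` that operator acts as `1`, so it joins the scalar; `c
      -- + 1` still avoids all `-n`.
      refine ih (c := c + 1) (fun n => ?_) ?_
      · have := h0 (n + 1)
        rwa [Nat.cast_succ, add_comm (n : k), ← add_assoc] at this
      · have h2 := congrArg (q i) h
        rw [map_add, map_add, map_smul, hcomm, ← Module.End.mul_apply (q i) (q i), hq,
          map_zero, ← add_assoc] at h2
        rwa [add_smul, one_smul]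
    rw [h1, zero_add] at h
    exact ih h0 h

theorem apply_eq_zero_of_sum_idempotent [Fintype ι] (hq : ∀ i, q i * q i = q i)
    (hc : ∀ i j, q i * q j = q j * q i) {v : V} (h : (∑ i, q i) v = 0) (i : ι) : q i v = 0 := by
  classical
  -- Applying `q i` to the equation turns its own summand into the scalar `1` acting on `q i v`.
  refine eq_zero_of_smul_add_sum_idempotent hq hc (Finset.univ.erase i) (c := 1)
    (fun n => by rw [add_comm]; exact Nat.cast_add_one_ne_zero n) ?_
  have h1 : (∑ j, q j) = q i + ∑ j ∈ Finset.univ.erase i, q j :=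
    (Finset.add_sum_erase _ _ (Finset.mem_univ i)).symm
  have h2 : q i * (∑ j, q j) = q i + (∑ j ∈ Finset.univ.erase i, q j) * q i := by
    rw [h1, mul_add, hq, Finset.mul_sum, Finset.sum_mul]
    simp only [hc i]
  have h3 := LinearMap.congr_fun h2 v
  rw [Module.End.mul_apply, h, map_zero] at h3
  rw [one_smul]
  exact h3.symm

/-- An eigenvalue counts idempotents that act as `1`. Over `ℂ` this makes it real without any
positivity of a form. -/
theorem eigenvalue_sum_idempotent [Fintype ι] (hq : ∀ i, q i * q i = q i)
    (hc : ∀ i j, q i * q j = q j * q i) {c : k} {v : V} (hv : v ≠ 0) (h : (∑ i, q i) v = c • v) :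
    ∃ n : ℕ, c = n := by
  by_contra! h1
  refine hv (eq_zero_of_smul_add_sum_idempotent hq hc Finset.univ (c := -c) (fun n hn => ?_) ?_)
  · exact h1 n (neg_add_eq_zero.1 hn)
  · rw [h, neg_smul, neg_add_cancel]

theorem isSemisimple_of_idempotent [FiniteDimensional k V] {f : Module.End k V} (hf : f * f = f) :
    f.IsSemisimple := by
  refine Module.End.isSemisimple_of_squarefree_aeval_eq_zero
    (p := Polynomial.X * (Polynomial.X - Polynomial.C 1)) ?_ ?_
  · refine (Polynomial.Separable.mul Polynomial.separable_X (Polynomial.separable_X_sub_C) ?_).squarefree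
    simpa using Polynomial.isCoprime_X_sub_C_of_isUnit_sub (a := (0 : k)) (b := 1) (by simp)
  · simp [mul_sub, hf]

/-- Each idempotent is killed by the squarefree polynomial `X (X - 1)`, and over a perfect field
sums of commuting semisimple operators are semisimple. -/
theorem isSemisimple_sum_idempotent [FiniteDimensional k V] (hq : ∀ i, q i * q i = q i)
    (hc : ∀ i j, q i * q j = q j * q i) (s : Finset ι) : (∑ i ∈ s, q i).IsSemisimple := by
  classical
  induction s using Finset.induction_on with
  | empty => simp
  | insert i s hi ih =>
    rw [Finset.sum_insert hi]
    exact (isSemisimple_of_idempotent (hq i)).add_of_commute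
      (Commute.sum_right _ _ _ fun j _ => hc i j) ih

theorem isInternal_eigenspace [DecidableEq k] [IsAlgClosed k] [FiniteDimensional k V] {f : Module.End k V}
    (hf : f.IsSemisimple) : DirectSum.IsInternal fun μ : k => f.eigenspace μ := by
  refine DirectSum.isInternal_submodule_of_iSupIndep_of_iSup_eq_top f.eigenspaces_iSupIndep ?_
  rw [← Module.End.iSup_maxGenEigenspace_eq_top f]
  exact iSup_congr fun μ => (hf.isFinitelySemisimple.maxGenEigenspace_eq_eigenspace μ).symm

end CommutingIdempotents

/-! ### Rows and columns of matrix homomorphisms. -/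

section Biproduct

variable {k A : Type*} [Field k] [CommRing A] [HopfAlgebra k A] [IsCocomm k A]
variable {m n : Type*} [Fintype m] [Fintype n]

/-- A matrix homomorphism is the convolution product of its rows. -/
theorem matrixHom_eq_prod (M : m → n → (A →ₐc[k] A)) :
    toConv (matrixHom M) = ∏ i, toConv ((incl k A i).comp (liftHom fun j => M i j)) := by
  refine WithConv.ofConv_injective (BialgHom.coe_toAlgHom_injective (algHom_ext' fun j a => ?_))
  refine (liftHom_incl _ j a).trans ?_
  have h := DFunLike.congr_fun (convProd_comp Finset.univ (incl k A j)
    fun i => toConv ((incl k A i).comp (liftHom fun j => M i j))) a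
  refine Eq.trans ?_ h.symm
  rw [colHom]
  congr 3
  funext i
  congr 1
  exact BialgHom.ext fun a => congrArg (inclAlg k A i) (liftHom_incl _ j a).symm

variable (k A) in
/-- The projection of a tensor power to a tensor factor. -/
def proj [DecidableEq m] (i : m) : TensorPower k m A →ₐc[k] A :=
  liftHom fun j => if j = i then BialgHom.id k A else (1 : WithConv (A →ₐc[k] A)).ofConv

/-- After projection, every convolution factor other than the `i`-th becomes the trivial
homomorphism, the unit of convolution. -/
theorem proj_colHom [DecidableEq m] (M : m → (A →ₐc[k] A)) (i : m) :
    (proj k A i).comp (colHom M) = M i := by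
  rw [colHom, comp_convProd]
  refine congrArg ofConv (Finset.prod_eq_single (M := WithConv (A →ₐc[k] A)) i ?_ ?_) |>.trans ?_
  · intro j _ hj
    refine WithConv.ofConv_injective (BialgHom.ext fun a => ?_)
    refine (liftHom_incl _ j _).trans ?_
    rw [if_neg hj]
    exact congrArg (algebraMap k A) (CoalgHomClass.counit_comp_apply (M j) a)
  · simp
  · refine BialgHom.ext fun a => (liftHom_incl _ i _).trans ?_
    rw [if_pos rfl]
    rfl

theorem proj_matrixHom [DecidableEq m] (M : m → n → (A →ₐc[k] A)) (i : m) :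
    (proj k A i).comp (matrixHom M) = liftHom fun j => M i j := by
  refine BialgHom.coe_toAlgHom_injective (algHom_ext' fun j a => ?_)
  refine (congrArg (proj k A i) (liftHom_incl _ j a)).trans ?_
  refine (DFunLike.congr_fun (proj_colHom (fun i => M i j) i) a).trans ?_
  exact (liftHom_incl _ j a).symm

end Biproduct

/-! ### The kernel of a matrix homomorphism as the intersection of the kernels of its rows. -/

section KernelMem

variable {k A B C : Type*} [Field k] [CommRing A] [HopfAlgebra k A] [IsCocomm k A]
  [CommRing B] [HopfAlgebra k B] [CommRing C] [HopfAlgebra k C]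

theorem mem_hopfKer_comp {g : A →ₐc[k] B} {a : A} (ha : a ∈ hopfKer g) (h : B →ₐc[k] C) :
    a ∈ hopfKer (h.comp g) := by
  rw [mem_hopfKer] at ha ⊢
  have h1 : ((h.comp g : A →ₐc[k] C) : A →ₗ[k] C) = (h : B →ₗ[k] C) ∘ₗ (g : A →ₗ[k] B) := rfl
  rw [h1, LinearMap.lTensor_comp_apply, ha]
  simp

theorem mem_hopfKer_convOne (a : A) : a ∈ hopfKer (1 : WithConv (A →ₐc[k] B)).ofConv := by
  have h1 : (((1 : WithConv (A →ₐc[k] B)).ofConv : A →ₐc[k] B) : A →ₗ[k] B) =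
    Algebra.linearMap k B ∘ₗ counit := rfl
  rw [mem_hopfKer, h1, LinearMap.lTensor_comp_apply, Coalgebra.lTensor_counit_comul]
  simp

/-- By coassociativity the relevant tensor is `a^(1) ⊗ f(a^(2)) g(a^(3))`. Membership for `g`
removes the last leg, then membership for `f` the middle one. -/
theorem mem_hopfKer_convMul {f g : WithConv (A →ₐc[k] B)} {a : A} (hf : a ∈ hopfKer f.ofConv)
    (hg : a ∈ hopfKer g.ofConv) : a ∈ hopfKer (f * g).ofConv := by
  rw [mem_hopfKer] at hf hg ⊢
  have h1 : ((f * g).ofConv : A →ₗ[k] B) = LinearMap.mul' k B ∘ₗ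
      TensorProduct.map (f.ofConv : A →ₗ[k] B) (g.ofConv : A →ₗ[k] B) ∘ₗ comul :=
    LinearMap.ext fun x => convMul_apply f g x
  have h2 : ∀ z : A ⊗[k] A, ((f * g).ofConv : A →ₗ[k] B).lTensor A z =
      (LinearMap.mul' k B).lTensor A (TensorProduct.assoc k A B B
        (((f.ofConv : A →ₗ[k] B).lTensor A).rTensor B
        ((g.ofConv : A →ₗ[k] B).lTensor (A ⊗[k] A) ((TensorProduct.assoc k A A A).symm
          (comul.lTensor A z))))) := by
    intro z
    rw [h1]
    induction z with
    | zero => simp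
    | add x y hx hy => simp only [map_add, hx, hy]
    | tmul x y =>
      simp only [LinearMap.lTensor_tmul, LinearMap.comp_apply]
      generalize comul (R := k) y = z
      induction z with
      | zero => simp
      | add x y hx hy => simp only [map_add, TensorProduct.tmul_add, hx, hy]
      | tmul y z => simp
  have h3 : ∀ z : A ⊗[k] A, (g.ofConv : A →ₗ[k] B).lTensor (A ⊗[k] A) (comul.rTensor A z) =
      comul.rTensor B ((g.ofConv : A →ₗ[k] B).lTensor A z) := by
    intro z
    induction z with
    | zero => simp
    | add x y hx hy => simp only [map_add, hx, hy]
    | tmul x y => simp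
  rw [h2, Coalgebra.coassoc_symm_apply, h3, hg, LinearMap.rTensor_tmul, LinearMap.rTensor_tmul, hf]
  simp

theorem mem_hopfKer_convProd {ι : Type*} (s : Finset ι) (f : ι → WithConv (A →ₐc[k] B)) {a : A}
    (h : ∀ i, a ∈ hopfKer (f i).ofConv) : a ∈ hopfKer (∏ i ∈ s, f i).ofConv := by
  classical
  induction s using Finset.induction_on with
  | empty => exact mem_hopfKer_convOne a
  | insert i s hi ih =>
    rw [Finset.prod_insert hi]
    exact mem_hopfKer_convMul (h i) ih

/-- Projecting to a factor recovers a row, and the convolution product of the included rows recovers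
the matrix. For `∂₋` this identifies the cycles with the elements fixed by all `(-)`-stabilizers. -/
theorem mem_hopfKer_matrixHom {m n : Type*} [Fintype m] [Fintype n] {M : m → n → (A →ₐc[k] A)}
    {a : TensorPower k n A} :
    a ∈ hopfKer (matrixHom M) ↔ ∀ i, a ∈ hopfKer (liftHom fun j => M i j) := by
  classical
  constructor
  · intro h i
    rw [← proj_matrixHom]
    exact mem_hopfKer_comp h _
  · intro h
    rw [show matrixHom M = _ from congrArg ofConv (matrixHom_eq_prod M)]
    exact mem_hopfKer_convProd _ _ fun i => mem_hopfKer_comp (h i) _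

end KernelMem

/-! ### The stabilizers as commuting idempotents and the description of the ground space. -/

section Stabilizers

/-- This matches the factor in `S⁺(x₊)` with a column of `∂₊` applied to the integral. -/
theorem map_iteratedComul {k A m : Type*} [Field k] [CommRing A] [HopfAlgebra k A] [IsCocomm k A]
    [Fintype m] (f : m → (A →ₐc[k] A)) (a : A) :
    PiTensorProduct.map (fun c => (f c : A →ₗ[k] A)) (iteratedComul k A m a) = colHom f a := by
  have h1 : ∀ x, PiTensorProduct.map (fun c => (f c : A →ₗ[k] A)) x =
      liftHom (fun c => (incl k A c).comp (f c)) x := by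
    intro x
    induction x using PiTensorProduct.induction_on with
    | add x y hx hy => simp only [map_add, hx, hy]
    | smul_tprod c v =>
      rw [map_smul, map_smul, PiTensorProduct.map_tprod, tprod_eq_prod]
      congr 1
      exact (liftAlg_tprod (fun c => ((incl k A c).comp (f c) : A →ₐ[k] TensorPower k m A)) v).symm
  have h2 : (liftHom fun c => (incl k A c).comp (f c)).comp (iteratedComul k A m) = colHom f := by
    rw [iteratedComul, colHom, comp_convProd, colHom]
    congr 2
    funext c
    exact WithConv.ofConv_injective (BialgHom.ext fun a => liftHom_incl _ c a)
  exact (h1 _).trans (DFunLike.congr_fun h2 a)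

variable {R : Type u} [CommRing R] (X : ShortAbstractComplex.{u, w} R)
variable {k A : Type*} [Field k] [CommRing A] [HopfAlgebra k A] [IsCocomm k A]
variable (φ : RAction R k A)

theorem stabPlus_eq (p : X.Plus) : stabPlus X φ p =
    LinearMap.mulLeft k (boundaryPlus X φ (inclAlg k A p (normalizedIntegral k A))) := by
  rw [stabPlus, map_iteratedComul]
  congr 1
  exact (liftHom_incl (fun p => colHom fun c => φ (X.incPlus p c)) p _).symm

theorem stabMinus_eq (m : X.Minus) : stabMinus X φ m =
    average (liftHom fun c => φ (X.incMinus c m)) (normalizedCointegral k A) := rfl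

theorem mem_cycles {v : TotalSpace X k A} :
    v ∈ Cycles X φ ↔ ∀ m, v ∈ hopfKer (liftHom fun c => φ (X.incMinus c m)) :=
  mem_hopfKer_matrixHom

theorem boundaryPlus_mem (x : TensorPower k X.Plus A) : boundaryPlus X φ x ∈ Cycles X φ :=
  (hopfKerLift (boundaryMinus X φ) (boundaryPlus X φ) (boundary_comp X φ) x).2

/-- The idempotents `id - S⁺(x₊)` and `id - S⁻(x₋)`. -/
def stabComplement : X.Plus ⊕ X.Minus → Module.End k (TotalSpace X k A) :=
  Sum.elim (fun p => 1 - stabPlus X φ p) (fun m => 1 - stabMinus X φ m)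

theorem elementaryOperator_eq : elementaryOperator X φ = ∑ i, stabComplement X φ i := by
  rw [Fintype.sum_sum_type]
  rfl

variable [CharZero k] [Module.Finite k A]

theorem stabComplement_comm (i j : X.Plus ⊕ X.Minus) :
    stabComplement X φ i * stabComplement X φ j = stabComplement X φ j * stabComplement X φ i := by
  have h1 : ∀ p p', Commute (stabPlus X φ p) (stabPlus X φ p') := fun p p' => by
    rw [stabPlus_eq, stabPlus_eq]
    exact LinearMap.ext fun v => mul_left_comm _ _ v
  -- The relation `∂₋ ∘ ∂₊ = 1` enters here: the multiplier of `S⁺` lies in the kernel over which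
  -- the average is linear.
  have h2 : ∀ p m, Commute (stabPlus X φ p) (stabMinus X φ m) := fun p m => by
    rw [stabPlus_eq, stabMinus_eq]
    exact LinearMap.ext fun v =>
      (average_mul_of_mem ((mem_cycles X φ).1 (boundaryPlus_mem X φ _) m) v).symm
  have h3 : ∀ m m', Commute (stabMinus X φ m) (stabMinus X φ m') :=
    fun m m' => average_comm _ _ _ _
  have h4 : ∀ {a b : Module.End k (TotalSpace X k A)}, Commute a b → (1 - a) * (1 - b) =
      (1 - b) * (1 - a) := fun h =>
    ((Commute.one_left _).sub_left (((Commute.one_left _).sub_left h.symm).symm)).eq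
  rcases i with i | i <;> rcases j with j | j
  · exact h4 (h1 i j)
  · exact h4 (h2 i j)
  · exact h4 (h2 j i).symm
  · exact h4 (h3 i j)

variable (hA : ∃ σ : A, IsNormalizedIntegral k σ)
include hA

theorem stabComplement_mul_self (i : X.Plus ⊕ X.Minus) :
    stabComplement X φ i * stabComplement X φ i = stabComplement X φ i := by
  rcases i with p | m
  · refine IsIdempotentElem.one_sub (a := stabPlus X φ p) (LinearMap.ext fun v => ?_)
    have h := (isNormalizedIntegral_normalizedIntegral hA).mul_self
    rw [stabPlus_eq]
    change _ * (_ * v) = _ * v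
    rw [← mul_assoc, ← map_mul, ← map_mul, h]
  · exact IsIdempotentElem.one_sub (a := stabMinus X φ m) (LinearMap.ext fun v =>
      average_average (isNormalizedCointegral_normalizedCointegral k A) v)

theorem isNormalizedIntegral_tprod (ι : Type*) [Fintype ι] : IsNormalizedIntegral k
    (PiTensorProduct.tprod k fun _ : ι => normalizedIntegral k A) :=
  (isNormalizedIntegral_normalizedIntegral hA).tprod

/-- The integral of the tensor power is the product of the included integrals; conversely it absorbs
each of them, because their counit is `1`. -/
theorem forall_boundaryPlus_mul_eq_iff (v : TotalSpace X k A) :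
    (∀ p, boundaryPlus X φ (inclAlg k A p (normalizedIntegral k A)) * v = v) ↔
    boundaryPlus X φ (PiTensorProduct.tprod k fun _ => normalizedIntegral k A) * v = v := by
  classical
  constructor
  · intro h
    rw [tprod_eq_prod, map_prod]
    refine Finset.prod_induction _ (fun z => z * v = v) (fun x y hx hy => ?_) (one_mul v)
      fun p _ => h p
    rw [mul_assoc, hy, hx]
  · intro h p
    rw [← h, ← mul_assoc, ← map_mul, (isNormalizedIntegral_tprod hA X.Plus).mul_right, counit_incl,
      (isNormalizedIntegral_normalizedIntegral hA).normalized, one_smul]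

/-- The ground space consists of the cycles fixed by the image of the integral under `∂₊`. -/
theorem elementaryOperator_eq_zero_iff (v : TotalSpace X k A) :
    elementaryOperator X φ v = 0 ↔ v ∈ Cycles X φ ∧
      boundaryPlus X φ (PiTensorProduct.tprod k fun _ => normalizedIntegral k A) * v = v := by
  have hσ := isNormalizedCointegral_normalizedCointegral k A
  rw [← forall_boundaryPlus_mul_eq_iff X φ hA, mem_cycles, elementaryOperator_eq]
  constructor
  · intro h
    -- A vector killed by the sum of commuting idempotents is killed by each, so it is fixed by all
    -- stabilizers.
    have h1 := apply_eq_zero_of_sum_idempotent (stabComplement_mul_self X φ hA)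
      (stabComplement_comm X φ) h
    constructor
    · intro m
      have h2 : average (liftHom fun c => φ (X.incMinus c m)) (normalizedCointegral k A) v = v :=
        (sub_eq_zero.1 (h1 (Sum.inr m))).symm
      rw [← h2]
      exact average_mem hσ v
    · intro p
      have h2 : v = stabPlus X φ p v := sub_eq_zero.1 (h1 (Sum.inl p))
      rw [stabPlus_eq] at h2
      exact h2.symm
  · rintro ⟨h1, h2⟩
    rw [LinearMap.sum_apply]
    refine Finset.sum_eq_zero fun i _ => ?_
    rcases i with p | m
    · change v - stabPlus X φ p v = 0
      rw [stabPlus_eq, sub_eq_zero]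
      exact (h2 p).symm
    · change v - stabMinus X φ m v = 0
      rw [stabMinus_eq, average_of_mem hσ (h1 m), sub_self]

end Stabilizers

/-! ### Compatibility of integrals, averages and trace forms with the star operation. -/

section Star

variable {A B : Type*} [CommRing A] [HopfAlgebra ℂ A] [CommRing B] [HopfAlgebra ℂ B]
  (s : HopfStar A) (t : HopfStar B)

theorem star_rid (f : A →ₗ[ℂ] ℂ) (f' : A →ₗ[ℂ] ℂ) (h : ∀ a, f (s.star a) = conj (f' a))
    (z : A ⊗[ℂ] A) :
    TensorProduct.rid ℂ A (f.lTensor A (TensorProduct.map s.star s.star z)) =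
      s.star (TensorProduct.rid ℂ A (f'.lTensor A z)) := by
  induction z using TensorProduct.induction_on with
  | zero => simp
  | add x y hx hy => simp only [_root_.map_add, hx, hy]
  | tmul x y => simp [h]

theorem IsNormalizedIntegral.star {σ : A} (hσ : IsNormalizedIntegral ℂ σ) : s.star σ = σ := by
  refine IsNormalizedIntegral.unique (.of_mul_left (fun a => ?_) ?_) hσ
  · rw [← s.star_star a, ← s.star_mul, hσ.mul_right, LinearMap.map_smulₛₗ, s.star_star,
      ← s.counit_star, s.star_star]
  · rw [s.counit_star, hσ.normalized, map_one]

/-- The functional `a ↦ conj (l (a*))` is again a normalized cointegral, so uniqueness applies. -/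
theorem IsNormalizedCointegral.star [IsCocomm ℂ A] {l : A →ₗ[ℂ] ℂ}
    (hl : IsNormalizedCointegral ℂ l) (a : A) : l (s.star a) = conj (l a) := by
  let l' : A →ₗ[ℂ] ℂ :=
    { toFun := fun a => conj (l (s.star a))
      map_add' := by simp
      map_smul' := by simp }
  have h : IsNormalizedCointegral ℂ l' := by
    refine .of_comul_right (fun a => ?_) ?_
    · have h1 := star_rid s l l' (fun a => (Complex.conj_conj _).symm) (comul a)
      rw [← s.comul_star, hl.comul_right] at h1
      rw [← s.star_star (TensorProduct.rid ℂ A _), ← h1, LinearMap.map_smulₛₗ, s.star_one]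
      rfl
    · change conj (l (s.star 1)) = 1
      rw [s.star_one, hl.normalized, map_one]
  exact (Complex.conj_conj _).symm.trans (congrArg conj (LinearMap.congr_fun (h.unique hl) a))

variable {s t}

theorem star_average [IsCocomm ℂ A] {g : A →ₐc[ℂ] B} (hg : StarCompat s t g) {l : B →ₗ[ℂ] ℂ}
    (hl : ∀ b, l (t.star b) = conj (l b)) (a : A) :
    average g l (s.star a) = s.star (average g l a) := by
  refine Eq.trans ?_ (star_rid s (l ∘ₗ (g : A →ₗ[ℂ] B)) (l ∘ₗ (g : A →ₗ[ℂ] B)) (fun a => ?_)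
    (comul a))
  · rw [← s.comul_star]
    rfl
  · exact (congrArg l (hg a)).trans (hl _)

theorem StarCompat.liftHom {ι : Type*} [Fintype ι] (f : ι → A →ₐc[ℂ] B)
    (hf : ∀ i, StarCompat s t (f i)) :
    StarCompat (s.tensorPower ι) t (HopfComplex.liftHom f) := by
  intro x
  refine antilinear_ext
    (f := (HopfComplex.liftHom f : TensorPower ℂ ι A →ₗ[ℂ] B).comp (s.tensorPower ι).star)
    (g := t.star.comp (HopfComplex.liftHom f : TensorPower ℂ ι A →ₗ[ℂ] B))
    ?_ ?_ ?_ ?_ ?_ x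
  · simp [HopfStar.star_one]
  · simp [HopfStar.star_one]
  · intro x y; simp [HopfStar.star_mul, mul_comm]
  · intro x y; simp [HopfStar.star_mul, mul_comm]
  · intro i a
    have h2 : (s.tensorPower ι).star (inclAlg ℂ A i a) = inclAlg ℂ A i (s.star a) :=
      tensorStar_incl s i a
    simp only [LinearMap.comp_apply, h2]
    refine (liftHom_incl _ i _).trans ((hf i a).trans ?_)
    exact congrArg t.star (liftHom_incl _ i a).symm

theorem hermitianForm_apply [IsCocomm ℂ A] [Module.Finite ℂ A]
    (h : ∃ σ : A, IsNormalizedIntegral ℂ σ) (v w : A) :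
    s.hermitianForm v w = Algebra.trace ℂ A (s.star v * w) :=
  frobeniusForm_apply h _ _

/-- The trace is a real multiple, by the dimension, of a functional that turns `*` into conjugation,
and `(v* w)* = w* v`. -/
theorem hermitianForm_symm [IsCocomm ℂ A] [Module.Finite ℂ A]
    (h : ∃ σ : A, IsNormalizedIntegral ℂ σ) (v w : A) :
    conj (s.hermitianForm v w) = s.hermitianForm w v := by
  rw [hermitianForm_apply h, hermitianForm_apply h, trace_eq, trace_eq, map_mul,
    ← (isNormalizedCointegral_normalizedCointegral ℂ A).star s, s.star_mul, s.star_star,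
    Complex.conj_natCast]

end Star

/-! ### Hermiticity of the elementary operator and orthogonality of its eigenspaces. -/

section SpaceStar

variable {R : Type u} [CommRing R] (X : ShortAbstractComplex.{u, w} R)
variable {A : Type*} [CommRing A] [HopfAlgebra ℂ A] [IsCocomm ℂ A] [Module.Finite ℂ A]
  {s : HopfStar A} {φ : RAction R ℂ A} (hφ : ∀ r, StarCompat s s (φ r))
  (hA : ∃ σ : A, IsNormalizedIntegral ℂ σ)

include hA

theorem exists_integral_totalSpace : ∃ σ : TotalSpace X ℂ A, IsNormalizedIntegral ℂ σ :=
  ⟨_, isNormalizedIntegral_tprod hA _⟩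

include hφ

theorem hermitianForm_stabComplement (i : X.Plus ⊕ X.Minus) (v w : TotalSpace X ℂ A) :
    (totalSpaceStar X s).hermitianForm (stabComplement X φ i v) w =
      (totalSpaceStar X s).hermitianForm v (stabComplement X φ i w) := by
  have hV := exists_integral_totalSpace X hA
  suffices h : ∀ S : Module.End ℂ (TotalSpace X ℂ A), (∀ v w,
      (totalSpaceStar X s).hermitianForm (S v) w = (totalSpaceStar X s).hermitianForm v (S w)) →
      (totalSpaceStar X s).hermitianForm ((1 - S) v) w =
        (totalSpaceStar X s).hermitianForm v ((1 - S) w) by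
    rcases i with p | m
    · refine h (stabPlus X φ p) fun v w => ?_
      -- The normalized integral is fixed by `*` and `∂₊` commutes with `*`, so `S⁺` is
      -- multiplication by a self-adjoint element.
      have h1 : (totalSpaceStar X s).star (boundaryPlus X φ
          (inclAlg ℂ A p (normalizedIntegral ℂ A))) =
          boundaryPlus X φ (inclAlg ℂ A p (normalizedIntegral ℂ A)) := by
        refine (StarCompat.matrixHom (s := s) _ (fun _ _ => hφ _) _).symm.trans ?_
        refine congrArg (boundaryPlus X φ) ((tensorStar_incl s p _).trans ?_)
        rw [(isNormalizedIntegral_normalizedIntegral hA).star]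
      rw [hermitianForm_apply hV, hermitianForm_apply hV, stabPlus_eq, LinearMap.mulLeft_apply,
        LinearMap.mulLeft_apply, HopfStar.star_mul, h1, mul_assoc]
    · refine h (stabMinus X φ m) fun v w => ?_
      have hl := isNormalizedCointegral_normalizedCointegral ℂ A
      have h1 : StarCompat (totalSpaceStar X s) s (liftHom fun c => φ (X.incMinus c m)) :=
        StarCompat.liftHom _ fun _ => hφ _
      -- The average commutes with `*`, which leaves its self-adjointness for the bilinear trace
      -- form.
      rw [hermitianForm_apply hV, hermitianForm_apply hV, stabMinus_eq,
        ← star_average h1 (hl.star s), trace_eq, trace_eq, cointegral_average_mul hl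
          (isNormalizedCointegral_normalizedCointegral ℂ _)]
  intro S hS
  simp only [LinearMap.sub_apply, Module.End.one_apply, map_sub, hS]

theorem hermitianForm_elementaryOperator (v w : TotalSpace X ℂ A) :
    (totalSpaceStar X s).hermitianForm (elementaryOperator X φ v) w =
      (totalSpaceStar X s).hermitianForm v (elementaryOperator X φ w) := by
  simp only [elementaryOperator_eq, LinearMap.sum_apply, map_sum,
    hermitianForm_stabComplement X hφ hA]

theorem hermitianForm_eigenspace {μ ν : ℂ} (hμ : μ ≠ ν) {v w : TotalSpace X ℂ A}
    (hv : elementaryOperator X φ v = μ • v) (hw : elementaryOperator X φ w = ν • w) :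
    (totalSpaceStar X s).hermitianForm v w = 0 := by
  by_cases h0 : v = 0
  · rw [h0, map_zero, LinearMap.zero_apply]
  have h1 := hv
  rw [elementaryOperator_eq] at h1
  -- The form may be indefinite, so Hermiticity alone does not make `μ` real; as a natural number it
  -- equals its conjugate.
  obtain ⟨n, rfl⟩ := eigenvalue_sum_idempotent (stabComplement_mul_self X φ hA)
    (stabComplement_comm X φ) h0 h1
  have h2 := hermitianForm_elementaryOperator X hφ hA v w
  rw [hv, hw, LinearMap.map_smulₛₗ, LinearMap.map_smul, LinearMap.smul_apply,
    Complex.conj_natCast, smul_eq_mul, smul_eq_mul, ← sub_eq_zero, ← sub_mul] at h2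
  exact (mul_eq_zero.1 h2).resolve_left (sub_ne_zero.2 hμ)

end SpaceStar

/-! ### The ground space and the homology. -/

section Homology

variable {R : Type u} [CommRing R] (X : ShortAbstractComplex.{u, w} R)
variable {k A : Type*} [Field k] [CharZero k] [CommRing A] [HopfAlgebra k A] [IsCocomm k A]
  [Module.Finite k A] (φ : RAction R k A) (hA : ∃ σ : A, IsNormalizedIntegral k σ)

theorem homologyClass_surjective : Function.Surjective (homologyClass X φ) :=
  hopfCokerHom_surjective _

instance : Module.Finite k (Homology X φ) :=
  Module.Finite.of_surjective (homologyClass X φ : Cycles X φ →ₗ[k] Homology X φ)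
    (homologyClass_surjective X φ)

include hA

theorem exists_integral_homology : ∃ σ : Homology X φ, IsNormalizedIntegral k σ := by
  obtain ⟨σ, hσ⟩ := exists_integral_hopfKer (boundaryMinus X φ)
    ⟨_, isNormalizedIntegral_tprod hA X.Circ⟩
  exact ⟨_, hσ.map (homologyClass_surjective X φ)⟩

theorem homologyClass_eq_zero_iff (v : Cycles X φ) : homologyClass X φ v = 0 ↔
    boundaryPlus X φ (PiTensorProduct.tprod k fun _ => normalizedIntegral k A) *
      (v : TotalSpace X k A) = 0 :=
  (hopfCokerHom_eq_zero_iff _ (isNormalizedIntegral_tprod hA X.Plus) v).trans Subtype.ext_iff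

theorem trace_homologyClass {v : Cycles X φ} (hv : boundaryPlus X φ
    (PiTensorProduct.tprod k fun _ => normalizedIntegral k A) * (v : TotalSpace X k A) = v) :
    Algebra.trace k (Homology X φ) (homologyClass X φ v) =
      Algebra.trace k (Cycles X φ) v :=
  trace_hopfCoker _ (isNormalizedIntegral_tprod hA X.Plus) (Subtype.ext hv)

/-- The ground space is isomorphic to the homology, by a nonzero multiple of `v ↦ [v]`. -/
theorem exists_groundSpace_equiv {c : k} (hc : c ≠ 0) :
    ∃ f : (elementaryOperator X φ).eigenspace 0 ≃ₗ[k] Homology X φ,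
      ∀ v : (elementaryOperator X φ).eigenspace 0,
        ∃ hv : (v : TotalSpace X k A) ∈ Cycles X φ, f v = c • homologyClass X φ ⟨v, hv⟩ := by
  have hσ := isNormalizedIntegral_tprod hA X.Plus
  set P := boundaryPlus X φ (PiTensorProduct.tprod k fun _ => normalizedIntegral k A) with hP
  have hmem : ∀ v, v ∈ (elementaryOperator X φ).eigenspace 0 ↔ v ∈ Cycles X φ ∧ P * v = v := by
    intro v
    rw [Module.End.mem_eigenspace_iff, zero_smul, elementaryOperator_eq_zero_iff X φ hA]
  let f : (elementaryOperator X φ).eigenspace 0 →ₗ[k] Homology X φ :=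
    { toFun := fun v => c • homologyClass X φ ⟨v, ((hmem v).1 v.2).1⟩
      map_add' := fun v w => by
        rw [← smul_add, ← map_add]
        rfl
      map_smul' := fun a v => by
        rw [RingHom.id_apply, smul_comm, ← map_smul]
        rfl }
  refine ⟨LinearEquiv.ofBijective f ⟨?_, ?_⟩, fun v => ⟨((hmem v).1 v.2).1, rfl⟩⟩
  -- If the class of `v` vanishes then `P v = 0`, whereas `P v = v` on the ground space.
  · refine (injective_iff_map_eq_zero f).2 fun v hv => Subtype.ext ?_
    have h1 := (homologyClass_eq_zero_iff X φ hA _).1 ((smul_eq_zero.1 hv).resolve_left hc)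
    exact ((hmem v).1 v.2).2.symm.trans h1
  · intro x
    obtain ⟨b, rfl⟩ := homologyClass_surjective X φ x
    -- The class of `P` in the homology is `1`, so `P b` represents the same class as `b` and is
    -- fixed by `P`; `c⁻¹` undoes the scaling in `f`.
    have h1 : P * (c⁻¹ • (b : TotalSpace X k A)) ∈ Cycles X φ :=
      mul_mem (boundaryPlus_mem X φ _) (Subalgebra.smul_mem _ b.2 _)
    have h2 : P * P = P := hσ.map_mul_self _
    refine ⟨⟨P * (c⁻¹ • (b : TotalSpace X k A)), (hmem _).2 ⟨h1, by rw [← mul_assoc, h2]⟩⟩, ?_⟩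
    change c • homologyClass X φ ⟨P * (c⁻¹ • (b : TotalSpace X k A)), h1⟩ = homologyClass X φ b
    rw [← map_smul, ← sub_eq_zero, ← map_sub, homologyClass_eq_zero_iff X φ hA]
    change P * (c • (P * (c⁻¹ • (b : TotalSpace X k A))) - (b : TotalSpace X k A)) = 0
    rw [mul_smul_comm, smul_smul, mul_inv_cancel₀ hc, one_smul, mul_sub, ← mul_assoc, h2, sub_self]

end Homology

/-! ### Existence of integrals for semisimple Hopf algebras and their complexifications. -/

section Integrals

/-- A semisimple commutative Hopf algebra has a normalized integral. -/
theorem exists_integral_of_isSemisimpleRing {k B : Type*} [Field k] [CommRing B] [HopfAlgebra k B]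
    [IsSemisimpleRing B] : ∃ σ : B, IsNormalizedIntegral k σ := by
  obtain ⟨I, hI⟩ := exists_isCompl (RingHom.ker (counitAlgHom k B) : Ideal B)
  -- The integral is the component of `1` in an ideal complementary to the augmentation ideal.
  obtain ⟨a, ha, σ, hσ, h1⟩ := Submodule.mem_sup.1
    ((hI.sup_eq_top).symm ▸ Submodule.mem_top : (1 : B) ∈ RingHom.ker (counitAlgHom k B) ⊔ I)
  have hε : counit (R := k) σ = 1 := by
    have h2 := congrArg (counitAlgHom k B) h1
    rwa [map_add, RingHom.mem_ker.1 ha, zero_add, map_one] at h2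
  refine ⟨σ, .of_mul_left (fun b => ?_) hε⟩
  have h2 : b - algebraMap k B (counit b) ∈ RingHom.ker (counitAlgHom k B) := by
    simp [RingHom.mem_ker]
  -- The product lies in both complementary ideals, so it is zero, which is the integral property.
  have h3 : σ * (b - algebraMap k B (counit b)) ∈ RingHom.ker (counitAlgHom k B) ⊓ I :=
    ⟨Ideal.mul_mem_left _ _ h2, Ideal.mul_mem_right _ _ hσ⟩
  rw [hI.inf_eq_bot, Submodule.mem_bot, mul_sub, sub_eq_zero] at h3
  rw [h3, mul_comm, Algebra.smul_def]

theorem IsNormalizedIntegral.complexification {B : Type*} [CommRing B] [HopfAlgebra ℝ B]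
    {σ : B} (hσ : IsNormalizedIntegral ℝ σ) :
    IsNormalizedIntegral ℂ (1 ⊗ₜ[ℝ] σ : Complexification B) := by
  refine .of_mul_left (fun a => ?_) (by simp [hσ.normalized])
  induction a using TensorProduct.induction_on with
  | zero => simp
  | add x y hx hy => rw [mul_add, hx, hy, _root_.map_add, add_smul]
  | tmul c b => simp [hσ.mul_left, TensorProduct.smul_tmul', TensorProduct.tmul_smul]

theorem hasNormalizedIntegrals_of_exists_integral {k C : Type*} [Field k] [CharZero k] [CommRing C]
    [HopfAlgebra k C] [IsCocomm k C] [Module.Finite k C] (h : ∃ σ : C, IsNormalizedIntegral k σ) :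
    HasNormalizedIntegrals k C :=
  ⟨h, _, isNormalizedCointegral_trace⟩

end Integrals

end

end HopfComplex

theorem theorem202012271301 {R : Type*} [CommRing R] {B : Type*} [CommRing B] [HopfAlgebra ℝ B]
    [Coalgebra.IsCocomm ℝ B] [Module.Finite ℝ B] (hB : IsBisemisimple ℝ B)
    (τ : B →ₐc[ℝ] B) (hτ : ∀ b, τ (τ b) = b)
    (ψ : RAction R ℝ B) (hψ : ∀ r b, ψ r (τ b) = τ (ψ r b))
    (X : ShortAbstractComplex R) :
    let A := Complexification B
    let φ : RAction R ℂ A := ψ.complexification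
    let s : HopfStar A := HopfStar.complexification τ hτ
    let hφ : ∀ r, StarCompat s s (φ r) := ψ.complexification_star τ hτ hψ
    let V := TotalSpace X ℂ A
    let H := Homology X φ
    let T : Module.End ℂ V := elementaryOperator X φ
    let e := (totalSpaceStar X s).hermitianForm
    let eH := (homologyStar X hφ).hermitianForm
    HasNormalizedIntegrals ℂ A ∧ HasNormalizedIntegrals ℂ V ∧ HasNormalizedIntegrals ℂ H ∧
    (∀ v w, conj (e v w) = e w v) ∧ (∀ x y, conj (eH x y) = eH y x) ∧
    (∀ v w, e (T v) w = e v (T w)) ∧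
    DirectSum.IsInternal (fun μ : ℂ => T.eigenspace μ) ∧
    (∀ μ ν : ℂ, μ ≠ ν → ∀ v ∈ T.eigenspace μ, ∀ w ∈ T.eigenspace ν, e v w = 0) ∧
    T.HasEigenvalue 0 ∧
    ∃ f : T.eigenspace 0 ≃ₗ[ℂ] H,
      (∀ v : T.eigenspace 0, ∃ hv : (v : V) ∈ Cycles X φ, f v =
        ((√((Module.finrank ℂ V : ℝ) / (Module.finrank ℂ (Cycles X φ) : ℝ)) : ℝ) : ℂ) •
          homologyClass X φ ⟨v, hv⟩) ∧
      ∀ v w : T.eigenspace 0, eH (f v) (f w) = e v w := by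
  intro A φ s hφ V H T e eH
  have hB' := hB.semisimple
  have hA : ∃ σ : A, IsNormalizedIntegral ℂ σ := by
    obtain ⟨σ, hσ⟩ := exists_integral_of_isSemisimpleRing (k := ℝ) (B := B)
    exact ⟨_, hσ.complexification⟩
  have hV := exists_integral_totalSpace X hA
  have hH := exists_integral_homology X φ hA
  have hq := stabComplement_mul_self X φ hA
  have hc := stabComplement_comm X φ
  have hdV := finrank_cast_ne_zero ℂ V
  have hdK := finrank_cast_ne_zero ℂ (Cycles X φ)
  have hd : ((√((Module.finrank ℂ V : ℝ) / (Module.finrank ℂ (Cycles X φ) : ℝ)) : ℝ) : ℂ) *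
      ((√((Module.finrank ℂ V : ℝ) / (Module.finrank ℂ (Cycles X φ) : ℝ)) : ℝ) : ℂ) =
      Module.finrank ℂ V / Module.finrank ℂ (Cycles X φ) := by
    rw [← Complex.ofReal_mul, Real.mul_self_sqrt (by positivity)]
    simp
  -- The square root is nonzero because its square, the ratio of dimensions, is.
  obtain ⟨f, hf⟩ := exists_groundSpace_equiv X φ hA
    (left_ne_zero_of_mul (hd.trans_ne (div_ne_zero hdV hdK)))
  refine ⟨hasNormalizedIntegrals_of_exists_integral hA,
    hasNormalizedIntegrals_of_exists_integral hV, hasNormalizedIntegrals_of_exists_integral hH,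
    hermitianForm_symm hV, hermitianForm_symm hH, hermitianForm_elementaryOperator X hφ hA,
    isInternal_eigenspace ?_, fun μ ν hμ v hv w hw => hermitianForm_eigenspace X hφ hA hμ
      (Module.End.mem_eigenspace_iff.1 hv) (Module.End.mem_eigenspace_iff.1 hw), ?_, f, hf, ?_⟩
  · rw [show T = _ from elementaryOperator_eq X φ]
    exact isSemisimple_sum_idempotent hq hc _
  -- If the ground space were zero, so would be the homology, but there the counit separates `1`
  -- from `0`.
  · intro h
    have h1 : Subsingleton H := by
      have : Subsingleton (T.eigenspace 0) := Submodule.subsingleton_iff_eq_bot.2 h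
      exact f.symm.injective.subsingleton
    exact not_nontrivial H (nontrivial_of_hopfAlgebra ℂ H)
  · intro v w
    obtain ⟨hv, hfv⟩ := hf v
    obtain ⟨hw, hfw⟩ := hf w
    have hPw := ((elementaryOperator_eq_zero_iff X φ hA w).1 ((Module.End.mem_eigenspace_iff.1
      w.2).trans (zero_smul ℂ _))).2
    have hsv : (totalSpaceStar X s).star v ∈ Cycles X φ :=
      star_mem_hopfKer (StarCompat.matrixHom _ fun _ _ => hφ _) hv
    have h1 : (homologyStar X hφ).star (homologyClass X φ ⟨v, hv⟩) * homologyClass X φ ⟨w, hw⟩ =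
        homologyClass X φ (⟨_, hsv⟩ * ⟨w, hw⟩) := rfl
    -- It suffices that `P w = w`, since then `P` fixes the product `v* w` as well.
    have h2 := trace_homologyClass X φ hA (v := ⟨_, hsv⟩ * ⟨w, hw⟩)
      ((mul_left_comm _ _ _).trans (congrArg _ hPw))
    rw [hfv, hfw]
    simp only [eH, e]
    -- The scalar of `f` is real, so it contributes its square `dim V / dim K`, the factor that
    -- turns the trace of the cycles into that of `V`.
    rw [LinearMap.map_smul, LinearMap.map_smulₛₗ, LinearMap.smul_apply, Complex.conj_ofReal,
      smul_smul, hd, hermitianForm_apply hH, hermitianForm_apply hV, h1, h2, smul_eq_mul,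
      ← trace_hopfKer]
    rfl
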